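/- Let $G'$ be a finite directed multigraph with node set $\{1,\dots,v'\}$, with $e'$ edges and with no isolated nodes. Let $f:\mathbb N\to\mathbb N$ satisfy $f(0)=e'$, $f(t)=0$ for $1\le t\le v'-1$, and $f(t)\ge 1$ for $t\ge v'$. The process $\mathrm{MPA}_f(G')$ is the random sequence of directed multigraphs $G(1),G(2),\dots$ defined as follows. $G(1)=\dots=G(v')=G'$. For $t\ge v'$, the multigraph $G(t)$ has node set $\{1,\dots,t\}$, and $G(t+1)$ arises from $G(t)$ by adding the node $t+1$ and $f(t)$ edges starting at $t+1$, whose end-points are chosen from $\{1,\dots,t\}$ independently of each other (with replacement) and, given $G(t)$, of the earlier history, each node $u$ being chosen with probability proportional to its degree in $G(t)$. (The degree of $u$ is the number of edges starting at $u$ plus the number of edges ending at $u$.) A witness request $W=\{(u_i,m_i)\mid 1\le i\le n\}$ consists of distinct nodes $u_1,\dots,u_n\in\{1,2,3,\dots\}$ and non-negative integers $m_1,\dots,m_n$. Let $W[t]$ be the event that $u_1,\dots,u_n$ are nodes of $G(t)$ and that $G(t)$ has a node $v\notin\{u_1,\dots,u_n\}$ which, for every $i$, is joined to $u_i$ by exactly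 $m_i$ edges (irrespective of their directions). Proposition. Suppose that $f(t)=\Theta(t)$, that is, there are constants $c_2\ge c_1>0$ with $c_1t\le f(t)\le c_2t$ for all large enough $t$. Let $t_0\ge1$, let $G(t_0)$ be a state which the process has at time $t_0$ with positive probability, let $W$ be a witness request, and let $\varepsilon>0$. Then there exists $t_1>t_0$ such that $$\mathbf P\big(W[t_1]\ \big|\ G(t_0)\big)>1-\varepsilon .$$ -/

import Mathlib

open MeasureTheory ProbabilityTheory Filter Asymptotics
open scoped ENNReal

/-- A finite directed multigraph whose nodes are natural numbers: an edge is a pair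
`(start-point, end-point)` and the edges form a multiset. -/
@[ext]
structure DirMultigraph where
  verts : Finset ℕ
  edges : Multiset (ℕ × ℕ)
  start_mem : ∀ e ∈ edges, e.1 ∈ verts
  end_mem : ∀ e ∈ edges, e.2 ∈ verts

namespace DirMultigraph

/-- The degree of `u`: the number of edges starting at `u` plus the number of edges ending
at `u`. -/
def degree (G : DirMultigraph) (u : ℕ) : ℕ :=
  G.edges.countP (fun e => e.1 = u) + G.edges.countP (fun e => e.2 = u)

/-- The number of edges joining `u` and `v`, in either direction. -/
def multiplicity (G : DirMultigraph) (u v : ℕ) : ℕ :=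
  G.edges.countP (fun e => e = (u, v) ∨ e = (v, u))

/-- `G` contains a witness for the request `{(u i, m i)}`: all the `u i` are nodes of `G`, and
some node `v` of `G`, different from all of them, is joined to each `u i` by exactly `m i`
edges. -/
def HasWitness (G : DirMultigraph) {n : ℕ} (u m : Fin n → ℕ) : Prop :=
  (∀ i, u i ∈ G.verts) ∧
    ∃ v ∈ G.verts, ∀ i, v ≠ u i ∧ G.multiplicity v (u i) = m i

/-- Add the node `v` to `G`, together with `k` edges starting at `v`, with end-points
`c 0, …, c (k - 1)`. -/
def attach (G : DirMultigraph) (v : ℕ) {k : ℕ} (c : Fin k → G.verts) : DirMultigraph where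
  verts := insert v G.verts
  edges := G.edges + (Finset.univ : Finset (Fin k)).val.map (fun j => (v, (c j : ℕ)))
  start_mem := by
    intro e he
    rcases Multiset.mem_add.1 he with h | h
    · exact Finset.mem_insert_of_mem (G.start_mem e h)
    · obtain ⟨j, -, rfl⟩ := Multiset.mem_map.1 h
      exact Finset.mem_insert_self _ _
  end_mem := by
    intro e he
    rcases Multiset.mem_add.1 he with h | h
    · exact Finset.mem_insert_of_mem (G.end_mem e h)
    · obtain ⟨j, -, rfl⟩ := Multiset.mem_map.1 h
      exact Finset.mem_insert_of_mem (c j).2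

theorem tsum_degree_ne_zero (G : DirMultigraph) (h : G.edges ≠ 0) :
    ∑' u : G.verts, (G.degree u : ℝ≥0∞) ≠ 0 := by
  obtain ⟨e, he⟩ := Multiset.exists_mem_of_ne_zero h
  intro h0
  have h1 := ENNReal.tsum_eq_zero.1 h0 ⟨e.1, G.start_mem e he⟩
  have h2 : 0 < G.edges.countP (fun e' => e'.1 = e.1) :=
    Multiset.countP_pos_of_mem he rfl
  simp only [degree, Nat.cast_eq_zero, Nat.add_eq_zero_iff] at h1
  exact h2.ne' h1.1

theorem tsum_degree_ne_top (G : DirMultigraph) :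
    ∑' u : G.verts, (G.degree u : ℝ≥0∞) ≠ ⊤ := by
  rw [tsum_fintype]
  exact ENNReal.sum_ne_top.2 fun _ _ => ENNReal.natCast_ne_top _

/-- The random node of `G` chosen with probability directly proportional to its degree. -/
noncomputable def endpointPMF (G : DirMultigraph) (h : G.edges ≠ 0) : PMF G.verts :=
  PMF.normalize (fun u => (G.degree u : ℝ≥0∞)) (G.tsum_degree_ne_zero h) G.tsum_degree_ne_top

instance : MeasurableSpace DirMultigraph := ⊤

end DirMultigraph

/-- The law of `k` independent samples from `p`. -/
noncomputable def iidPMF {α : Type*} [Fintype α] (p : PMF α) (k : ℕ) : PMF (Fin k → α) :=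
  PMF.ofFintype (fun c => ∏ j, p (c j)) (by
    have hp : ∑ a, p a = 1 := by rw [← tsum_fintype (L := .unconditional _)]; exact p.tsum_coe
    rw [← Fintype.prod_sum (fun (_ : Fin k) a => p a)]
    simp [hp])

/-- One step of preferential attachment: the new node `v` arrives with `k` edges starting at it,
whose end-points are chosen independently, with replacement, with probabilities directly
proportional to the degrees in `G`. (The rule is void for a multigraph without edges, which never
occurs in the process; such a multigraph is left as it is.) -/
noncomputable def attachPMF (v k : ℕ) (G : DirMultigraph) : PMF DirMultigraph :=
  open Classical in
  if h : G.edges ≠ 0 then (iidPMF (G.endpointPMF h) k).map (G.attach v) else PMF.pure G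

/-- The law of `G(t+1)` given `G(t)` in the process started from a multigraph with `v₀` nodes:
nothing happens while `t < v₀`, and for `t ≥ v₀` the new node `t + 1` arrives with `f t` edges. -/
noncomputable def mpaStep (f : ℕ → ℕ) (v₀ t : ℕ) (G : DirMultigraph) : PMF DirMultigraph :=
  if t < v₀ then PMF.pure G else attachPMF (t + 1) (f t) G

/-- The transition from the history `(G(0), …, G(t))` to `G(t+1)`, which depends on `G(t)` only. -/
noncomputable def mpaKernel (f : ℕ → ℕ) (v₀ t : ℕ) :
    Kernel (∀ _ : Finset.Iic t, DirMultigraph) DirMultigraph where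
  toFun h := (mpaStep f v₀ t (h ⟨t, Finset.mem_Iic.2 le_rfl⟩)).toMeasure
  measurable' :=
    (measurable_from_top (f := fun G : DirMultigraph => (mpaStep f v₀ t G).toMeasure)).comp
      (measurable_pi_apply _)

instance (f : ℕ → ℕ) (v₀ t : ℕ) : IsMarkovKernel (mpaKernel f v₀ t) :=
  ⟨fun _ => PMF.toMeasure.isProbabilityMeasure _⟩

/-- The law of the preferential attachment process `(G(t))` with edge growth `f` and initial
multigraph `G₀`, on the space of sequences of multigraphs. By convention `G(0) = G₀`, so that
`G(t) = G₀` for all `t ≤ v₀`, where `v₀` is the number of nodes of `G₀`. -/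
noncomputable def mpaMeasure (f : ℕ → ℕ) (G₀ : DirMultigraph) : Measure (ℕ → DirMultigraph) :=
  Kernel.trajMeasure (X := fun _ => DirMultigraph) (Measure.dirac G₀)
    (mpaKernel f G₀.verts.card)

instance (f : ℕ → ℕ) (G₀ : DirMultigraph) : IsProbabilityMeasure (mpaMeasure f G₀) := by
  unfold mpaMeasure
  infer_instance

/-! Let e(t) be the number of edges and η(t) = f(t)/(2e(t)) the growth rate. Given G(t), the new
node t+1 sends deg(u)·η(t) edges to u on average, so mean degrees grow by the factor 1+η(t), while
e(t) grows by 1+2η(t). Since f(t) = Θ(t), e(t) = Θ(t²) and η(t) = Θ(1/t). Hence Ση² converges, and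
degrees grow like √e(t). As e(t)η(t)² = Θ(1), the mean number of edges from a new node to a fixed u
stays between positive constants, provided deg(u) follows its mean. The edges to the nodes of the
request then have the prescribed multiplicities with probability at least some δ > 0, at every late
step (`stepExp_noWitness_le_one_sub_mul`). Witnesses never disappear.

Degrees are controlled in two stages. Chebyshev's inequality, started from a state at time s, bounds
the chance that deg(u) strays from its mean by 4/deg(u), at each later time
(`chainExp_degree_deviation_le`). Moreover E[1/deg(u)] tends to 0: one step lowers it by at least
(η/4)·E[1/deg(u)]², and Ση diverges (`stepExp_inv_degree_le`, `eventually_lt_of_le_sub_mul_sq`). So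
from a late time T on, each single later time has a stray degree with probability at most ε/2. The
probability y of having no witness then satisfies y(l+1) ≤ (1-δ)y(l) + δε/2, and falls below ε. No
control of all times at once is needed.

The estimates concern finite sums (`stepExp`, `chainExp`); only the end relates them to the measure
on trajectories. -/

/-! ### Independent samples -/

/-- The expectation of `F` under `k` independent samples with weights `p`. -/
noncomputable def iidExp {V : Type*} [Fintype V] (p : V → ℝ) (k : ℕ) (F : (Fin k → V) → ℝ) : ℝ :=
  ∑ c, (∏ j, p (c j)) * F c

/-- The number of samples in `c` equal to `u`. -/
def hitCount {V : Type*} [DecidableEq V] {k : ℕ} (c : Fin k → V) (u : V) : ℕ :=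
  ∑ j, if c j = u then 1 else 0

theorem hitCount_cons {V : Type*} [DecidableEq V] {k : ℕ} (a : V) (c : Fin k → V) (u : V) :
    hitCount (Fin.cons a c : Fin (k + 1) → V) u = hitCount c u + if a = u then 1 else 0 := by
  rw [hitCount, Fin.sum_univ_succ]
  simp [hitCount, add_comm]

section iidExp

variable {V : Type*} [Fintype V] {p : V → ℝ} {k : ℕ}

theorem iidExp_zero (F : (Fin 0 → V) → ℝ) : iidExp p 0 F = F Fin.elim0 := by
  simp only [iidExp, Finset.univ_unique, Finset.sum_singleton, Finset.univ_eq_empty,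
    Finset.prod_empty, one_mul]
  congr

theorem iidExp_succ (F : (Fin (k + 1) → V) → ℝ) :
    iidExp p (k + 1) F = ∑ a, p a * iidExp p k (fun c => F (Fin.cons a c)) := by
  unfold iidExp
  rw [← (Fin.consEquiv fun _ => V).sum_comp, Fintype.sum_prod_type]
  refine Finset.sum_congr rfl fun a _ => ?_
  rw [Finset.mul_sum]
  refine Finset.sum_congr rfl fun c _ => ?_
  simp [Fin.consEquiv, Fin.prod_univ_succ, mul_assoc]

theorem iidExp_add (F F' : (Fin k → V) → ℝ) :
    iidExp p k (fun c => F c + F' c) = iidExp p k F + iidExp p k F' := by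
  simp [iidExp, mul_add, Finset.sum_add_distrib]

theorem iidExp_const_mul (a : ℝ) (F : (Fin k → V) → ℝ) :
    iidExp p k (fun c => a * F c) = a * iidExp p k F := by
  simp only [iidExp, Finset.mul_sum]
  exact Finset.sum_congr rfl fun c _ => by ring

theorem iidExp_mono (hp : ∀ a, 0 ≤ p a) {F F' : (Fin k → V) → ℝ} (h : ∀ c, F c ≤ F' c) :
    iidExp p k F ≤ iidExp p k F' :=
  Finset.sum_le_sum fun c _ =>
    mul_le_mul_of_nonneg_left (h c) (Finset.prod_nonneg fun _ _ => hp _)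

theorem iidExp_nonneg (hp : ∀ a, 0 ≤ p a) {F : (Fin k → V) → ℝ} (h : ∀ c, 0 ≤ F c) :
    0 ≤ iidExp p k F :=
  Finset.sum_nonneg fun c _ => mul_nonneg (Finset.prod_nonneg fun _ _ => hp _) (h c)

theorem iidExp_const (hp : ∑ a, p a = 1) (x : ℝ) : iidExp p k (fun _ => x) = x := by
  induction k with
  | zero => simp [iidExp_zero]
  | succ k ih => simp [iidExp_succ, ih, ← Finset.sum_mul, hp]

variable [DecidableEq V]

/-- Condition on whether the first sample is `u`. With `φ` arbitrary, this one recursion yields both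
moments and the probability of no hit. -/
theorem iidExp_hitCount_succ (hp : ∑ a, p a = 1) (u : V) (φ : ℕ → ℝ) :
    iidExp p (k + 1) (fun c => φ (hitCount c u)) =
      p u * iidExp p k (fun c => φ (hitCount c u + 1)) +
        (1 - p u) * iidExp p k (fun c => φ (hitCount c u)) := by
  rw [iidExp_succ, ← Finset.add_sum_erase _ _ (Finset.mem_univ u)]
  congr 1
  · simp [hitCount_cons]
  · have h : 1 - p u = ∑ a ∈ Finset.univ.erase u, p a := by
      rw [← hp, ← Finset.add_sum_erase _ _ (Finset.mem_univ u)]; ring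
    rw [h, Finset.sum_mul]
    refine Finset.sum_congr rfl fun a ha => ?_
    simp [hitCount_cons, Finset.ne_of_mem_erase ha]

/-- The shift `x` absorbs a first hit in the induction; in the application it is the current degree.
-/
theorem iidExp_add_hitCount (hp : ∑ a, p a = 1) (u : V) (x : ℝ) :
    iidExp p k (fun c => x + hitCount c u) = x + k * p u := by
  induction k generalizing x with
  | zero => simp [iidExp_zero, hitCount]
  | succ k ih =>
    have h1 := iidExp_hitCount_succ (k := k) hp u fun b => x + (b : ℝ)
    have h2 := ih (x + 1)
    rw [h1, ih x]
    have h3 : (fun c : Fin k → V => x + ((hitCount c u + 1 : ℕ) : ℝ)) =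
        fun c => x + 1 + (hitCount c u : ℝ) := by
      funext c; push_cast; ring
    rw [h3, h2]; push_cast; ring

theorem iidExp_add_hitCount_sq (hp : ∑ a, p a = 1) (u : V) (x : ℝ) :
    iidExp p k (fun c => (x + hitCount c u) ^ 2) = (x + k * p u) ^ 2 + k * (p u * (1 - p u)) := by
  induction k generalizing x with
  | zero => simp [iidExp_zero, hitCount]
  | succ k ih =>
    have h1 := iidExp_hitCount_succ (k := k) hp u fun b => (x + (b : ℝ)) ^ 2
    have h2 := ih (x + 1)
    rw [h1, ih x]
    have h3 : (fun c : Fin k → V => (x + ((hitCount c u + 1 : ℕ) : ℝ)) ^ 2) =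
        fun c => (x + 1 + (hitCount c u : ℝ)) ^ 2 := by
      funext c; push_cast; ring
    rw [h3, h2]; push_cast; ring

theorem iidExp_hitCount_eq_zero (hp : ∑ a, p a = 1) (u : V) :
    iidExp p k (fun c => if hitCount c u = 0 then 1 else 0) = (1 - p u) ^ k := by
  induction k with
  | zero => simp [iidExp_zero, hitCount]
  | succ k ih =>
    rw [iidExp_hitCount_succ hp u fun b => if b = 0 then 1 else 0, ih]
    have := iidExp_const (k := k) hp 0
    simp [this, pow_succ, mul_comm]

/-- The exact value is multinomial, with M = ∑ m i: the bound drops the coefficient M!/∏(m i)! and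
weakens q^(k-M) to q^k. The induction conditions on the first sample. Either it misses every `u i`,
or it hits one fixed `u i₀` still in demand; other hits are discarded, and Pascal's rule adds the
two terms. -/
theorem le_iidExp_hitCount_eq (hp0 : ∀ a, 0 ≤ p a) (hp : ∑ a, p a = 1) {n : ℕ} {u : Fin n → V}
    (hu : Function.Injective u) (m : Fin n → ℕ) :
    (k.choose (∑ i, m i) : ℝ) * (∏ i, p (u i) ^ m i) * (1 - ∑ i, p (u i)) ^ k ≤
      iidExp p k (fun c => if ∀ i, hitCount c (u i) = m i then 1 else 0) := by
  have hsplit : 1 - ∑ i, p (u i) = ∑ a ∈ (Finset.univ.image u)ᶜ, p a := by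
    rw [← hp, ← Finset.sum_add_sum_compl (Finset.univ.image u), Finset.sum_image (by simp [hu.injOn])]
    ring
  have hq0 : 0 ≤ 1 - ∑ i, p (u i) := hsplit ▸ Finset.sum_nonneg fun a _ => hp0 a
  have hq1 : 1 - ∑ i, p (u i) ≤ 1 := by
    have := Finset.sum_nonneg fun i (_ : i ∈ Finset.univ) => hp0 (u i); linarith
  induction k generalizing m with
  | zero =>
    rw [iidExp_zero]
    by_cases hm : ∀ i, m i = 0
    · simp [hm, hitCount]
    · have h1 : ∑ i, m i ≠ 0 := by simpa using hm
      rw [Nat.choose_eq_zero_of_lt (Nat.pos_of_ne_zero h1)]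
      simp only [CharP.cast_eq_zero, zero_mul]
      split_ifs <;> norm_num
  | succ k ih =>
    set q := 1 - ∑ i, p (u i) with hq
    set P : ℝ := ∏ i, p (u i) ^ m i with hP
    have hP0 : 0 ≤ P := Finset.prod_nonneg fun i _ => pow_nonneg (hp0 _) _
    have hnn : ∀ a, 0 ≤ p a * iidExp p k
        (fun c => if ∀ i, hitCount (Fin.cons a c : Fin (k + 1) → V) (u i) = m i then 1 else 0) :=
      fun a => mul_nonneg (hp0 a) (iidExp_nonneg hp0 fun c => by split_ifs <;> norm_num)
    rw [iidExp_succ, ← Finset.sum_compl_add_sum (Finset.univ.image u),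
      Finset.sum_image (by simp [hu.injOn])]
    have hout : q * iidExp p k (fun c => if ∀ i, hitCount c (u i) = m i then 1 else 0) =
        ∑ a ∈ (Finset.univ.image u)ᶜ, p a * iidExp p k
          (fun c => if ∀ i, hitCount (Fin.cons a c : Fin (k + 1) → V) (u i) = m i
            then 1 else 0) := by
      rw [hsplit, Finset.sum_mul]
      refine Finset.sum_congr rfl fun a ha => ?_
      have ha' : ∀ i, a ≠ u i := fun i h => by simp [h] at ha
      simp [hitCount_cons, ha']
    rw [← hout]
    have h1 := mul_le_mul_of_nonneg_left (ih m) hq0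
    by_cases hm : ∀ i, m i = 0
    · have h2 : 0 ≤ ∑ i, p (u i) * iidExp p k (fun c => if ∀ i', hitCount
          (Fin.cons (u i) c : Fin (k + 1) → V) (u i') = m i' then 1 else 0) :=
        Finset.sum_nonneg fun i _ => hnn (u i)
      have h3 : ∑ i, m i = 0 := by simpa using hm
      rw [h3] at h1 ⊢
      simp only [Nat.choose_zero_right, Nat.cast_one, one_mul] at h1 ⊢
      rw [pow_succ]
      linarith
    · push Not at hm
      obtain ⟨i₀, hi₀⟩ := hm
      -- The demand that remains once the first sample has hit `u i₀`.
      set m' : Fin n → ℕ := Function.update m i₀ (m i₀ - 1) with hm'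
      have hsum : ∑ i, m i = ∑ i, m' i + 1 := by
        rw [← Finset.add_sum_erase _ _ (Finset.mem_univ i₀),
          ← Finset.add_sum_erase _ m' (Finset.mem_univ i₀)]
        have : ∑ i ∈ Finset.univ.erase i₀, m' i = ∑ i ∈ Finset.univ.erase i₀, m i :=
          Finset.sum_congr rfl fun i hi => by simp [hm', Finset.ne_of_mem_erase hi]
        rw [this]
        simp [hm']; omega
      have hprod : P = p (u i₀) * ∏ i, p (u i) ^ m' i := by
        rw [hP, ← Finset.mul_prod_erase _ _ (Finset.mem_univ i₀),
          ← Finset.mul_prod_erase _ (fun i => p (u i) ^ m' i) (Finset.mem_univ i₀)]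
        have : ∏ i ∈ Finset.univ.erase i₀, p (u i) ^ m' i =
            ∏ i ∈ Finset.univ.erase i₀, p (u i) ^ m i :=
          Finset.prod_congr rfl fun i hi => by simp [hm', Finset.ne_of_mem_erase hi]
        rw [this, ← mul_assoc, ← pow_succ']
        simp only [hm', Function.update_self]
        congr 2; omega
      have h2 : p (u i₀) * iidExp p k (fun c => if ∀ i, hitCount c (u i) = m' i then 1 else 0) ≤
          ∑ i, p (u i) * iidExp p k (fun c => if ∀ i', hitCount
          (Fin.cons (u i) c : Fin (k + 1) → V) (u i') = m i' then 1 else 0) := by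
        refine le_trans (le_of_eq ?_)
          (Finset.single_le_sum (fun i _ => hnn (u i)) (Finset.mem_univ i₀))
        congr 2
        funext c
        have : (∀ i, hitCount c (u i) = m' i) ↔
            ∀ i', hitCount (Fin.cons (u i₀) c : Fin (k + 1) → V) (u i') = m i' := by
          refine forall_congr' fun i => ?_
          rw [hitCount_cons]
          by_cases h : i = i₀
          · subst h; simp [hm']; omega
          · have h' : u i₀ ≠ u i := fun h' => h (hu h').symm
            simp [hm', h, h']
        simp only [this]
      have h3 := mul_le_mul_of_nonneg_left (ih m') (hp0 (u i₀))
      have h4 : (k.choose (∑ i, m' i) : ℝ) * P * q ^ (k + 1) ≤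
          p (u i₀) * ((k.choose (∑ i, m' i) : ℝ) * (∏ i, p (u i) ^ m' i) * q ^ k) := by
        rw [hprod, pow_succ]
        have : 0 ≤ p (u i₀) * ((k.choose (∑ i, m' i) : ℝ) * (∏ i, p (u i) ^ m' i) * q ^ k) :=
          mul_nonneg (hp0 _) (mul_nonneg (mul_nonneg (Nat.cast_nonneg _)
            (Finset.prod_nonneg fun i _ => pow_nonneg (hp0 _) _)) (pow_nonneg hq0 _))
        nlinarith
      have h5 : ((k + 1).choose (∑ i, m i) : ℝ) =
          (k.choose (∑ i, m' i) : ℝ) + (k.choose (∑ i, m i) : ℝ) := by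
        rw [hsum, Nat.choose_succ_succ]; push_cast; rfl
      rw [h5]
      calc _ = (k.choose (∑ i, m' i) : ℝ) * P * q ^ (k + 1) +
            q * ((k.choose (∑ i, m i) : ℝ) * P * q ^ k) := by ring
        _ ≤ _ := by linarith

end iidExp

/-! ### Degrees and multiplicities when a node is attached -/

theorem Multiset.sum_countP_eq_card {α : Type*} (φ : α → ℕ) (V : Finset ℕ) (s : Multiset α)
    (h : ∀ a ∈ s, φ a ∈ V) : ∑ u ∈ V, s.countP (fun a => φ a = u) = card s := by
  induction s using Multiset.induction with
  | empty => simp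
  | cons a s ih =>
    simp only [Multiset.countP_cons, Finset.sum_add_distrib, Multiset.card_cons]
    rw [ih fun b hb => h b (Multiset.mem_cons_of_mem hb)]
    simp [h a (Multiset.mem_cons_self a s)]

namespace DirMultigraph

theorem sum_degree (G : DirMultigraph) :
    ∑ u ∈ G.verts, G.degree u = 2 * Multiset.card G.edges := by
  simp only [degree, Finset.sum_add_distrib]
  rw [Multiset.sum_countP_eq_card (fun e : ℕ × ℕ => e.1) _ _ G.start_mem,
    Multiset.sum_countP_eq_card (fun e : ℕ × ℕ => e.2) _ _ G.end_mem, two_mul]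

/-- The probability with which the node `u` is chosen. -/
noncomputable def weight (G : DirMultigraph) (u : G.verts) : ℝ :=
  (G.degree u : ℝ) / (2 * Multiset.card G.edges)

theorem weight_nonneg (G : DirMultigraph) (u : G.verts) : 0 ≤ G.weight u := by
  unfold weight; positivity

theorem sum_weight {G : DirMultigraph} (h : G.edges ≠ 0) : ∑ u, G.weight u = 1 := by
  have h1 : (∑ u : G.verts, (G.degree u : ℝ)) = 2 * Multiset.card G.edges := by
    rw [Finset.sum_coe_sort G.verts fun u => (G.degree u : ℝ)]
    exact_mod_cast G.sum_degree
  have h2 : (Multiset.card G.edges : ℝ) ≠ 0 := by simpa using h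
  simp only [weight]
  rw [← Finset.sum_div, h1, div_self (by positivity)]

variable {G : DirMultigraph} {v : ℕ} {k : ℕ}

theorem countP_attach (c : Fin k → G.verts) (P : ℕ × ℕ → Prop) [DecidablePred P] :
    (G.attach v c).edges.countP P = G.edges.countP P + ∑ j, if P (v, (c j : ℕ)) then 1 else 0 := by
  change Multiset.countP P (G.edges + _) = _
  rw [Multiset.countP_add, Multiset.countP_map, ← Finset.card_filter]
  rfl

theorem degree_attach (hv : v ∉ G.verts) (c : Fin k → G.verts) (u : G.verts) :
    (G.attach v c).degree u = G.degree u + hitCount c u := by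
  have hvu : v ≠ u := fun h => hv (h ▸ u.2)
  simp only [degree, countP_attach, hitCount, Subtype.ext_iff, hvu, if_false]
  simp only [Finset.sum_const_zero]
  ring

theorem le_degree_attach_self (c : Fin k → G.verts) : k ≤ (G.attach v c).degree v := by
  simp only [degree, countP_attach, if_true]
  simp
  omega

theorem multiplicity_eq_zero_of_notMem (hv : v ∉ G.verts) (u : ℕ) : G.multiplicity v u = 0 := by
  rw [multiplicity, Multiset.countP_eq_zero]
  rintro e he (rfl | rfl)
  · exact hv (G.start_mem _ he)
  · exact hv (G.end_mem _ he)

theorem multiplicity_attach_self (hv : v ∉ G.verts) (c : Fin k → G.verts) (u : G.verts) :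
    (G.attach v c).multiplicity v u = hitCount c u := by
  have hvu : v ≠ u := fun h => hv (h ▸ u.2)
  have h0 := multiplicity_eq_zero_of_notMem hv u
  rw [multiplicity] at h0 ⊢
  rw [countP_attach, h0, zero_add, hitCount]
  refine Finset.sum_congr rfl fun j _ => if_congr ?_ rfl rfl
  rw [Prod.mk.injEq, Prod.mk.injEq, Subtype.ext_iff]
  tauto

theorem multiplicity_attach (hv : v ∉ G.verts) (c : Fin k → G.verts) {w u : ℕ}
    (hw : w ∈ G.verts) (hu : u ∈ G.verts) :
    (G.attach v c).multiplicity w u = G.multiplicity w u := by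
  have hvu : v ≠ u := fun h => hv (h ▸ hu)
  have hvw : v ≠ w := fun h => hv (h ▸ hw)
  rw [multiplicity, countP_attach, multiplicity, Finset.sum_eq_zero, add_zero]
  intro j _
  rw [if_neg]
  rintro (h | h)
  · exact hvw (congrArg Prod.fst h)
  · exact hvu (congrArg Prod.fst h)

/-- All new edges start at the new node, so multiplicities between old nodes do not change. -/
theorem HasWitness.attach {n : ℕ} {u m : Fin n → ℕ} (h : G.HasWitness u m) (hv : v ∉ G.verts)
    (c : Fin k → G.verts) : (G.attach v c).HasWitness u m := by
  obtain ⟨hu, w, hw, hwu⟩ := h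
  refine ⟨fun i => Finset.mem_insert_of_mem (hu i), w, Finset.mem_insert_of_mem hw, fun i => ?_⟩
  rw [multiplicity_attach hv c hw (hu i)]
  exact hwu i

theorem hasWitness_attach {n : ℕ} {u : Fin n → G.verts} {m : Fin n → ℕ} (hv : v ∉ G.verts)
    (c : Fin k → G.verts) (h : ∀ i, hitCount c (u i) = m i) :
    (G.attach v c).HasWitness (fun i => u i) m := by
  refine ⟨fun i => Finset.mem_insert_of_mem (u i).2, v, Finset.mem_insert_self _ _, fun i => ?_⟩
  exact ⟨fun h => hv (h ▸ (u i).2), by rw [multiplicity_attach_self hv, h]⟩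

end DirMultigraph

/-! ### States of the process and iterated expectations -/

/-- The number of edges at time `t` of the process with edge growth `f` that starts from a
multigraph with `v₀` nodes and `e₀` edges. -/
def edgeCount (f : ℕ → ℕ) (v₀ e₀ t : ℕ) : ℕ := e₀ + ∑ s ∈ Finset.Ico v₀ t, f s

/-- The properties that every state at time `t` of the process has. -/
structure IsState (f : ℕ → ℕ) (v₀ e₀ t : ℕ) (G : DirMultigraph) : Prop where
  verts_eq : G.verts = Finset.Icc 1 (max t v₀)
  card_edges : Multiset.card G.edges = edgeCount f v₀ e₀ t
  degree_ne_zero : ∀ u ∈ G.verts, G.degree u ≠ 0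

/-- The expectation of `F (G (t + 1))` given `G t = G`. -/
noncomputable def stepExp (f : ℕ → ℕ) (v₀ t : ℕ) (F : DirMultigraph → ℝ) (G : DirMultigraph) : ℝ :=
  open Classical in
  if t < v₀ ∨ G.edges = 0 then F G
  else iidExp G.weight (f t) (fun c => F (G.attach (t + 1) c))

/-- The expectation of `F (G (s + l))` given `G s`. -/
noncomputable def chainExp (f : ℕ → ℕ) (v₀ s : ℕ) :
    ℕ → (DirMultigraph → ℝ) → DirMultigraph → ℝ
  | 0, F => F
  | l + 1, F => chainExp f v₀ s l (stepExp f v₀ (s + l) F)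

section Chain

variable {f : ℕ → ℕ} {v₀ e₀ s t l : ℕ} {G : DirMultigraph} {F F' : DirMultigraph → ℝ}

theorem edgeCount_succ (h : v₀ ≤ t) : edgeCount f v₀ e₀ (t + 1) = edgeCount f v₀ e₀ t + f t := by
  rw [edgeCount, Finset.sum_Ico_succ_top h, edgeCount, add_assoc]

theorem edgeCount_pos (he : 1 ≤ e₀) : 0 < edgeCount f v₀ e₀ t := by unfold edgeCount; omega

namespace IsState

theorem edges_ne_zero (hG : IsState f v₀ e₀ t G) (he : 1 ≤ e₀) : G.edges ≠ 0 := by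
  rw [← Multiset.card_pos, hG.card_edges]
  exact edgeCount_pos he

theorem mem_verts (hG : IsState f v₀ e₀ t G) (ht : v₀ ≤ t) {u : ℕ} :
    u ∈ G.verts ↔ 1 ≤ u ∧ u ≤ t := by
  rw [hG.verts_eq, max_eq_left ht, Finset.mem_Icc]

theorem succ_notMem (hG : IsState f v₀ e₀ t G) (ht : v₀ ≤ t) : t + 1 ∉ G.verts := by
  rw [hG.mem_verts ht]; omega

theorem attach (hG : IsState f v₀ e₀ t G) (ht : v₀ ≤ t) (hf : 1 ≤ f t)
    (c : Fin (f t) → G.verts) : IsState f v₀ e₀ (t + 1) (G.attach (t + 1) c) where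
  verts_eq := by
    ext u
    simp only [DirMultigraph.attach, Finset.mem_insert, hG.mem_verts ht, Finset.mem_Icc]
    omega
  card_edges := by
    simp [DirMultigraph.attach, hG.card_edges, edgeCount_succ ht]
  degree_ne_zero := by
    intro u hu
    rcases Finset.mem_insert.1 hu with rfl | hu
    · have := DirMultigraph.le_degree_attach_self (v := t + 1) c
      omega
    · have := DirMultigraph.degree_attach (hG.succ_notMem ht) c ⟨u, hu⟩
      have := hG.degree_ne_zero u hu
      simp only at *
      omega

theorem of_lt (hG : IsState f v₀ e₀ t G) (ht : t < v₀) : IsState f v₀ e₀ (t + 1) G where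
  verts_eq := by rw [hG.verts_eq]; congr 1; omega
  card_edges := by
    rw [hG.card_edges, edgeCount, edgeCount, Finset.Ico_eq_empty (by omega),
      Finset.Ico_eq_empty (by omega)]
  degree_ne_zero := hG.degree_ne_zero

end IsState

theorem stepExp_eq (hG : IsState f v₀ e₀ t G) (he : 1 ≤ e₀) (ht : v₀ ≤ t) :
    stepExp f v₀ t F G = iidExp G.weight (f t) (fun c => F (G.attach (t + 1) c)) := by
  rw [stepExp, if_neg]
  rintro (h | h)
  · omega
  · exact hG.edges_ne_zero he h

theorem stepExp_mono (he : 1 ≤ e₀) (hf : ∀ t, v₀ ≤ t → 1 ≤ f t) (hG : IsState f v₀ e₀ t G)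
    (h : ∀ G', IsState f v₀ e₀ (t + 1) G' → F G' ≤ F' G') :
    stepExp f v₀ t F G ≤ stepExp f v₀ t F' G := by
  by_cases ht : t < v₀
  · rw [stepExp, stepExp, if_pos (Or.inl ht), if_pos (Or.inl ht)]
    exact h G (hG.of_lt ht)
  · push Not at ht
    rw [stepExp_eq hG he ht, stepExp_eq hG he ht]
    exact iidExp_mono G.weight_nonneg fun c => h _ (hG.attach ht (hf t ht) c)

theorem stepExp_add : stepExp f v₀ t (fun G => F G + F' G) =
    fun G => stepExp f v₀ t F G + stepExp f v₀ t F' G := by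
  funext G
  unfold stepExp
  split_ifs
  · rfl
  · exact iidExp_add _ _

theorem stepExp_const_mul (a : ℝ) : stepExp f v₀ t (fun G => a * F G) =
    fun G => a * stepExp f v₀ t F G := by
  funext G
  unfold stepExp
  split_ifs
  · rfl
  · exact iidExp_const_mul _ _

theorem stepExp_const (x : ℝ) : stepExp f v₀ t (fun _ => x) = fun _ => x := by
  funext G
  unfold stepExp
  split_ifs with h
  · rfl
  · push Not at h
    exact iidExp_const (DirMultigraph.sum_weight h.2) _

/-- `chainExp` peels off the last step, so a one-step estimate valid on the states at time s + l can
be inserted under it. All recursions in `l` below arise in this way. -/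
theorem chainExp_mono (he : 1 ≤ e₀) (hf : ∀ t, v₀ ≤ t → 1 ≤ f t) (hG : IsState f v₀ e₀ s G)
    (h : ∀ G', IsState f v₀ e₀ (s + l) G' → F G' ≤ F' G') :
    chainExp f v₀ s l F G ≤ chainExp f v₀ s l F' G := by
  induction l generalizing F F' with
  | zero => exact h G hG
  | succ l ih => exact ih fun G' hG' => stepExp_mono he hf hG' h

theorem chainExp_congr (he : 1 ≤ e₀) (hf : ∀ t, v₀ ≤ t → 1 ≤ f t) (hG : IsState f v₀ e₀ s G)
    (h : ∀ G', IsState f v₀ e₀ (s + l) G' → F G' = F' G') :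
    chainExp f v₀ s l F G = chainExp f v₀ s l F' G :=
  le_antisymm (chainExp_mono he hf hG fun G' hG' => (h G' hG').le)
    (chainExp_mono he hf hG fun G' hG' => (h G' hG').ge)

theorem chainExp_add : chainExp f v₀ s l (fun G => F G + F' G) =
    fun G => chainExp f v₀ s l F G + chainExp f v₀ s l F' G := by
  induction l generalizing F F' with
  | zero => rfl
  | succ l ih => simp only [chainExp, stepExp_add, ih]

theorem chainExp_const_mul (a : ℝ) : chainExp f v₀ s l (fun G => a * F G) =
    fun G => a * chainExp f v₀ s l F G := by
  induction l generalizing F with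
  | zero => rfl
  | succ l ih => simp only [chainExp, stepExp_const_mul, ih]

theorem chainExp_const (x : ℝ) : chainExp f v₀ s l (fun _ => x) = fun _ => x := by
  induction l with
  | zero => rfl
  | succ l ih => simp only [chainExp, stepExp_const, ih]

theorem chainExp_sum {ι : Type*} (S : Finset ι) (Φ : ι → DirMultigraph → ℝ) :
    chainExp f v₀ s l (fun G => ∑ i ∈ S, Φ i G) = fun G => ∑ i ∈ S, chainExp f v₀ s l (Φ i) G := by
  classical
  induction S using Finset.induction with
  | empty => simp [chainExp_const]
  | insert a S ha ih => simp only [Finset.sum_insert ha, chainExp_add, ih]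

/-- The Markov property; it allows estimates to be restarted at an intermediate time. -/
theorem chainExp_chainExp (l' : ℕ) :
    chainExp f v₀ s (l + l') F = chainExp f v₀ s l (chainExp f v₀ (s + l) l' F) := by
  induction l' generalizing F with
  | zero => rfl
  | succ l' ih =>
    rw [← Nat.add_assoc]
    simp only [chainExp, ← ih, Nat.add_assoc]

end Chain

/-! ### Moments of the degree of a fixed node -/

/-- The factor by which the expected degree of a node grows from time `t` to `t + 1`, minus one. -/
noncomputable def growthRate (f : ℕ → ℕ) (v₀ e₀ t : ℕ) : ℝ := f t / (2 * edgeCount f v₀ e₀ t)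

/-- The factor by which the expected degree of a node grows from time `s` to `s + l`. -/
noncomputable def growthFactor (f : ℕ → ℕ) (v₀ e₀ s l : ℕ) : ℝ :=
  ∏ i ∈ Finset.range l, (1 + growthRate f v₀ e₀ (s + i))

/-- Bernoulli gives 1 + kp ≤ (1+p)^k, and (1-p)^k (1+p)^k ≤ 1. -/
theorem one_sub_pow_le {p : ℝ} (h0 : 0 ≤ p) (h1 : p ≤ 1) (k : ℕ) :
    (1 - p) ^ k ≤ 1 / (1 + k * p) := by
  have hk : 0 < 1 + (k : ℝ) * p := by positivity
  rw [le_div_iff₀ hk]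
  calc (1 - p) ^ k * (1 + k * p) ≤ (1 - p) ^ k * (1 + p) ^ k :=
        mul_le_mul_of_nonneg_left (one_add_mul_le_pow (by linarith) k)
          (pow_nonneg (by linarith) k)
    _ = (1 - p ^ 2) ^ k := by rw [← mul_pow]; ring
    _ ≤ 1 := pow_le_one₀ (by nlinarith) (by nlinarith)

section Degree

variable {f : ℕ → ℕ} {v₀ e₀ s t l : ℕ} {G : DirMultigraph} {u : ℕ}

theorem growthRate_nonneg : 0 ≤ growthRate f v₀ e₀ t := by unfold growthRate; positivity

theorem growthFactor_pos : 0 < growthFactor f v₀ e₀ s l :=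
  Finset.prod_pos fun _ _ => add_pos_of_pos_of_nonneg one_pos growthRate_nonneg

theorem growthFactor_succ : growthFactor f v₀ e₀ s (l + 1) =
    growthFactor f v₀ e₀ s l * (1 + growthRate f v₀ e₀ (s + l)) :=
  Finset.prod_range_succ _ _

theorem growthFactor_zero : growthFactor f v₀ e₀ s 0 = 1 := Finset.prod_range_zero _

theorem weight_le_one (hG : G.edges ≠ 0) (u : G.verts) : G.weight u ≤ 1 := by
  rw [← DirMultigraph.sum_weight hG]
  exact Finset.single_le_sum (fun a _ => G.weight_nonneg a) (Finset.mem_univ u)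

theorem IsState.mul_weight (hG : IsState f v₀ e₀ t G) (u : G.verts) :
    f t * G.weight u = G.degree u * growthRate f v₀ e₀ t := by
  rw [DirMultigraph.weight, growthRate, hG.card_edges]; ring

theorem IsState.one_le_degree (hG : IsState f v₀ e₀ t G) (ht : v₀ ≤ t) (h1 : 1 ≤ u) (hut : u ≤ t) :
    (1 : ℝ) ≤ G.degree u := by
  exact_mod_cast Nat.one_le_iff_ne_zero.2 (hG.degree_ne_zero u ((hG.mem_verts ht).2 ⟨h1, hut⟩))

theorem IsState.degree_le (hG : IsState f v₀ e₀ t G) :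
    (G.degree u : ℝ) ≤ 2 * edgeCount f v₀ e₀ t := by
  have : G.degree u ≤ 2 * Multiset.card G.edges := by
    rw [two_mul]
    exact add_le_add (Multiset.countP_le_card _ _) (Multiset.countP_le_card _ _)
  rw [hG.card_edges] at this
  exact_mod_cast this

theorem stepExp_degree_eq (hG : IsState f v₀ e₀ t G) (he : 1 ≤ e₀) (ht : v₀ ≤ t) (φ : ℕ → ℝ)
    (w : G.verts) :
    stepExp f v₀ t (fun G => φ (G.degree w)) G =
      iidExp G.weight (f t) (fun c => φ (G.degree w + hitCount c w)) := by
  rw [stepExp_eq hG he ht]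
  congr
  funext c
  rw [DirMultigraph.degree_attach (hG.succ_notMem ht)]

theorem stepExp_degree (hG : IsState f v₀ e₀ t G) (he : 1 ≤ e₀) (ht : v₀ ≤ t)
    (h1 : 1 ≤ u) (hut : u ≤ t) :
    stepExp f v₀ t (fun G => (G.degree u : ℝ)) G = (1 + growthRate f v₀ e₀ t) * G.degree u := by
  have hu := (hG.mem_verts ht).2 ⟨h1, hut⟩
  have h2 := stepExp_degree_eq hG he ht (fun d => (d : ℝ)) ⟨u, hu⟩
  simp only [Nat.cast_add] at h2
  rw [h2, iidExp_add_hitCount (DirMultigraph.sum_weight (hG.edges_ne_zero he)), hG.mul_weight]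
  ring

theorem stepExp_degree_sq_le (hG : IsState f v₀ e₀ t G) (he : 1 ≤ e₀) (ht : v₀ ≤ t)
    (h1 : 1 ≤ u) (hut : u ≤ t) :
    stepExp f v₀ t (fun G => (G.degree u : ℝ) ^ 2) G ≤
      (1 + growthRate f v₀ e₀ t) ^ 2 * (G.degree u : ℝ) ^ 2 +
        growthRate f v₀ e₀ t * G.degree u := by
  have hu := (hG.mem_verts ht).2 ⟨h1, hut⟩
  have h2 := stepExp_degree_eq hG he ht (fun d => (d : ℝ) ^ 2) ⟨u, hu⟩
  simp only [Nat.cast_add] at h2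
  rw [h2, iidExp_add_hitCount_sq (DirMultigraph.sum_weight (hG.edges_ne_zero he)), ← mul_assoc,
    hG.mul_weight]
  have h3 := G.weight_nonneg ⟨u, hu⟩
  have h4 : 0 ≤ (G.degree u : ℝ) * growthRate f v₀ e₀ t :=
    mul_nonneg (Nat.cast_nonneg _) growthRate_nonneg
  simp only
  nlinarith [mul_nonneg h4 h3]

/-- Any hit lowers 1/d to at most 1/(d+1), a drop of 1/(d(d+1)) ≥ 1/(2d²). There is no hit with
probability at most 1/(1+dη) ≤ 1/(1+η) ≤ 1 - η/2. -/
theorem stepExp_inv_degree_le (hG : IsState f v₀ e₀ t G) (he : 1 ≤ e₀) (ht : v₀ ≤ t)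
    (h1 : 1 ≤ u) (hut : u ≤ t) (hη : growthRate f v₀ e₀ t ≤ 1) :
    stepExp f v₀ t (fun G => (G.degree u : ℝ)⁻¹) G ≤
      (G.degree u : ℝ)⁻¹ - growthRate f v₀ e₀ t / 4 * ((G.degree u : ℝ)⁻¹) ^ 2 := by
  have hu := (hG.mem_verts ht).2 ⟨h1, hut⟩
  set w : G.verts := ⟨u, hu⟩ with hw
  have h2 := stepExp_degree_eq hG he ht (fun d => (d : ℝ)⁻¹) w
  simp only [Nat.cast_add] at h2
  rw [h2]
  have hsum := DirMultigraph.sum_weight (hG.edges_ne_zero he)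
  have hd1 : (1 : ℝ) ≤ G.degree w := hG.one_le_degree ht h1 hut
  set d : ℝ := (G.degree w : ℝ) with hd
  have hη0 := growthRate_nonneg (f := f) (v₀ := v₀) (e₀ := e₀) (t := t)
  have hmw := hG.mul_weight w
  set η := growthRate f v₀ e₀ t with hη'
  have hdd : 0 < d * (d + 1) := by positivity
  have key : iidExp G.weight (f t) (fun c => (d + hitCount c w)⁻¹) ≤
      iidExp G.weight (f t) (fun c => (d⁻¹ - (d * (d + 1))⁻¹) +
        (d * (d + 1))⁻¹ * if hitCount c w = 0 then 1 else 0) := by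
    refine iidExp_mono G.weight_nonneg fun c => ?_
    split_ifs with h
    · simp [h]
    · have h3 : (1 : ℝ) ≤ hitCount c w := by exact_mod_cast Nat.one_le_iff_ne_zero.2 h
      have h4 : d⁻¹ - (d * (d + 1))⁻¹ = (d + 1)⁻¹ := by field_simp; ring
      rw [h4, mul_zero, add_zero]
      exact inv_anti₀ (by linarith) (by linarith)
  refine key.trans ?_
  rw [iidExp_add, iidExp_const hsum, iidExp_const_mul, iidExp_hitCount_eq_zero hsum]
  have h5 := one_sub_pow_le (G.weight_nonneg w) (weight_le_one (hG.edges_ne_zero he) w) (f t)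
  rw [hmw] at h5
  have h6 : 1 / (1 + d * η) ≤ 1 / (1 + η) :=
    one_div_le_one_div_of_le (by linarith) (by nlinarith)
  have h7 : 1 / (1 + η) ≤ 1 - η / 2 := by
    rw [div_le_iff₀ (by linarith)]; nlinarith
  have h8 : (d * (d + 1))⁻¹ * (1 - G.weight w) ^ f t ≤ (d * (d + 1))⁻¹ * (1 - η / 2) :=
    mul_le_mul_of_nonneg_left (by linarith) (by positivity)
  have h9 : d⁻¹ ^ 2 ≤ 2 * (d * (d + 1))⁻¹ := by
    rw [inv_pow, ← div_eq_mul_inv, le_div_iff₀ hdd, inv_mul_le_iff₀ (by positivity)]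
    nlinarith
  nlinarith

theorem chainExp_degree (hG : IsState f v₀ e₀ s G) (he : 1 ≤ e₀)
    (hf : ∀ t, v₀ ≤ t → 1 ≤ f t) (hs : v₀ ≤ s) (h1 : 1 ≤ u) (hus : u ≤ s) :
    chainExp f v₀ s l (fun G => (G.degree u : ℝ)) G = growthFactor f v₀ e₀ s l * G.degree u := by
  induction l with
  | zero => rw [growthFactor_zero, one_mul]; rfl
  | succ l ih =>
    rw [chainExp, chainExp_congr he hf hG fun G' hG' =>
      stepExp_degree hG' he (by omega) h1 (by omega), chainExp_const_mul, growthFactor_succ]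
    simp only [ih]
    ring

/-- With growth factor P and initial degree d, the variance is at most (P² - P)d: a step multiplies
it by (1+η)² and adds at most ηPd, which preserves this form with slack η²Pd. -/
theorem chainExp_degree_sq_le (hG : IsState f v₀ e₀ s G) (he : 1 ≤ e₀)
    (hf : ∀ t, v₀ ≤ t → 1 ≤ f t) (hs : v₀ ≤ s) (h1 : 1 ≤ u) (hus : u ≤ s) :
    chainExp f v₀ s l (fun G => (G.degree u : ℝ) ^ 2) G ≤
      growthFactor f v₀ e₀ s l ^ 2 * (G.degree u : ℝ) ^ 2 +
        (growthFactor f v₀ e₀ s l ^ 2 - growthFactor f v₀ e₀ s l) * G.degree u := by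
  induction l with
  | zero => simp [growthFactor_zero, chainExp]
  | succ l ih =>
    refine (chainExp_mono he hf hG fun G' hG' =>
      stepExp_degree_sq_le hG' he (by omega) h1 (by omega)).trans ?_
    simp only [chainExp_add, chainExp_const_mul]
    rw [growthFactor_succ, chainExp_degree hG he hf hs h1 hus]
    have hη0 := growthRate_nonneg (f := f) (v₀ := v₀) (e₀ := e₀) (t := s + l)
    have hP := growthFactor_pos (f := f) (v₀ := v₀) (e₀ := e₀) (s := s) (l := l)
    set η := growthRate f v₀ e₀ (s + l)
    set P := growthFactor f v₀ e₀ s l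
    have h2 := mul_le_mul_of_nonneg_left ih (sq_nonneg (1 + η))
    have h3 : 0 ≤ η ^ 2 * P * (G.degree u : ℝ) := by positivity
    nlinarith

-- Chebyshev with mean Pd and variance at most P²d. As 1 ≤ d ≤ 2e, leaving the window [P/2, 3eP]
-- forces a deviation of at least Pd/2. The window depends on the time `s` but not on the state, so
-- the bound can later be averaged over states.
open Classical in
theorem chainExp_degree_deviation_le (hG : IsState f v₀ e₀ s G) (he : 1 ≤ e₀)
    (hf : ∀ t, v₀ ≤ t → 1 ≤ f t) (hs : v₀ ≤ s) (h1 : 1 ≤ u) (hus : u ≤ s) :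
    chainExp f v₀ s l (fun G' => if growthFactor f v₀ e₀ s l / 2 ≤ G'.degree u ∧
        (G'.degree u : ℝ) ≤ 3 * edgeCount f v₀ e₀ s * growthFactor f v₀ e₀ s l then 0 else 1) G ≤
      4 * (G.degree u : ℝ)⁻¹ := by
  have hP := growthFactor_pos (f := f) (v₀ := v₀) (e₀ := e₀) (s := s) (l := l)
  have hmean := chainExp_degree (l := l) hG he hf hs h1 hus
  have hsq := chainExp_degree_sq_le (l := l) hG he hf hs h1 hus
  have hd1 := hG.one_le_degree hs h1 hus
  have hd2 := hG.degree_le (u := u)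
  set P := growthFactor f v₀ e₀ s l
  set d : ℝ := (G.degree u : ℝ) with hd
  have hμ : 0 < (P * d / 2) ^ 2 := by positivity
  set a := ((P * d / 2) ^ 2)⁻¹ with ha
  have ha0 : 0 < a := by positivity
  -- The square is expanded so that linearity of `chainExp` reduces it to the first two moments.
  have key : ∀ G' : DirMultigraph, IsState f v₀ e₀ (s + l) G' →
      (if P / 2 ≤ G'.degree u ∧ (G'.degree u : ℝ) ≤ 3 * edgeCount f v₀ e₀ s * P then (0 : ℝ)
        else 1) ≤ a * (G'.degree u : ℝ) ^ 2 + (-(2 * a * (P * d)) * G'.degree u +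
          a * (P * d) ^ 2) := by
    intro G' _
    have e1 : a * (G'.degree u : ℝ) ^ 2 + (-(2 * a * (P * d)) * G'.degree u + a * (P * d) ^ 2) =
      a * ((G'.degree u : ℝ) - P * d) ^ 2 := by ring
    rw [e1]
    split_ifs with h
    · positivity
    · have h2 : (P * d / 2) ^ 2 ≤ ((G'.degree u : ℝ) - P * d) ^ 2 := by
        rw [sq_le_sq, abs_of_nonneg (by positivity), le_abs]
        by_cases h3 : P / 2 ≤ G'.degree u
        · left
          have h4 : 3 * (edgeCount f v₀ e₀ s : ℝ) * P < G'.degree u := by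
            by_contra! h5
            exact h ⟨h3, h5⟩
          nlinarith
        · right
          nlinarith
      calc (1 : ℝ) = a * (P * d / 2) ^ 2 := by rw [ha, inv_mul_cancel₀ hμ.ne']
        _ ≤ _ := mul_le_mul_of_nonneg_left h2 ha0.le
  refine (chainExp_mono he hf hG key).trans ?_
  simp only [chainExp_add, chainExp_const_mul, chainExp_const]
  rw [hmean]
  have h3 := mul_le_mul_of_nonneg_left hsq ha0.le
  have h4 : a * (P ^ 2 * d) = 4 * d⁻¹ := by
    rw [ha]; field_simp; norm_num
  have h5 : 0 ≤ a * (P * d) := by positivity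
  nlinarith

end Degree

/-! ### Two recursive inequalities -/

/-- From `N` on, `y` is nonincreasing. If it stayed above ε, the total decrease would be at least
(ε²/4)∑η, which is infinite. -/
theorem eventually_lt_of_le_sub_mul_sq {y η : ℕ → ℝ} {N : ℕ} (hy : ∀ l, N ≤ l → 0 ≤ y l)
    (hη : ∀ l, 0 ≤ η l) (h : ∀ l, N ≤ l → y (l + 1) ≤ y l - η l / 4 * y l ^ 2)
    (hsum : Tendsto (fun l => ∑ i ∈ Finset.range l, η i) atTop atTop) {ε : ℝ} (hε : 0 < ε) :
    ∀ᶠ l in atTop, y l < ε := by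
  have hanti : ∀ l, N ≤ l → ∀ j, y (l + j) ≤ y l := by
    intro l hl j
    induction j with
    | zero => exact le_rfl
    | succ j ih =>
      have h1 := h (l + j) (by omega)
      have h2 : 0 ≤ η (l + j) / 4 * y (l + j) ^ 2 :=
        mul_nonneg (by linarith [hη (l + j)]) (sq_nonneg _)
      rw [← add_assoc]
      linarith
  obtain ⟨L, hL, hyL⟩ : ∃ L, N ≤ L ∧ y L < ε := by
    by_contra! hc
    have h1 : ∀ j, y (N + j) ≤ y N - ε ^ 2 / 4 *
        (∑ i ∈ Finset.range (N + j), η i - ∑ i ∈ Finset.range N, η i) := by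
      intro j
      induction j with
      | zero => simp
      | succ j ih =>
        have h1 := h (N + j) (by omega)
        have h2 := hc (N + j) (by omega)
        have h3 : ε ^ 2 ≤ y (N + j) ^ 2 := by gcongr
        have h4 := mul_le_mul_of_nonneg_left h3 (hη (N + j))
        rw [← add_assoc, Finset.sum_range_succ]
        nlinarith
    obtain ⟨j, hj⟩ := ((tendsto_atTop.1 hsum (∑ i ∈ Finset.range N, η i + (y N + 1) / (ε ^ 2 / 4))).and
      (eventually_ge_atTop N)).exists
    obtain ⟨i, rfl⟩ := Nat.exists_eq_add_of_le hj.2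
    have h2 := h1 i
    have h3 := hy (N + i) (by omega)
    have h4 : (y N + 1) / (ε ^ 2 / 4) ≤
      ∑ i ∈ Finset.range (N + i), η i - ∑ i ∈ Finset.range N, η i := by linarith [hj.1]
    rw [div_le_iff₀ (by positivity)] at h4
    linarith
  filter_upwards [eventually_ge_atTop L] with l hl
  obtain ⟨j, rfl⟩ := Nat.exists_eq_add_of_le hl
  exact (hanti L hL j).trans_lt hyL

/-- The excess of `y` over β is at most (1-δ)^j after j steps. -/
theorem eventually_lt_of_le_contraction {y : ℕ → ℝ} {N : ℕ} {δ β : ℝ} (hδ0 : 0 < δ) (hδ1 : δ ≤ 1)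
    (hy : y N ≤ 1) (hβ : 0 ≤ β) (h : ∀ l, N ≤ l → y (l + 1) ≤ (1 - δ) * y l + δ * β)
    {ε : ℝ} (hε : 0 < ε) : ∀ᶠ l in atTop, y l < β + ε := by
  have h1 : ∀ j, y (N + j) ≤ β + (1 - δ) ^ j := by
    intro j
    induction j with
    | zero => simp; linarith
    | succ j ih =>
      have h2 := h (N + j) (by omega)
      have h3 := mul_le_mul_of_nonneg_left ih (by linarith : 0 ≤ 1 - δ)
      rw [← add_assoc, pow_succ]
      linarith
  obtain ⟨J, hJ⟩ := exists_pow_lt_of_lt_one hε (by linarith : 1 - δ < 1)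
  filter_upwards [eventually_ge_atTop (N + J)] with l hl
  obtain ⟨j, rfl⟩ := Nat.exists_eq_add_of_le hl
  have h2 := h1 (J + j)
  rw [← add_assoc] at h2
  have h3 : (1 - δ) ^ (J + j) ≤ (1 - δ) ^ J :=
    pow_le_pow_of_le_one (by linarith) (by linarith) (by omega)
  linarith

/-! ### Asymptotics of edge count and growth factor -/

theorem exists_edgeCount_bounds {f : ℕ → ℕ} (v₀ e₀ : ℕ)
    (hf : (fun t => (f t : ℝ)) =Θ[atTop] (fun t : ℕ => (t : ℝ))) :
    ∃ c > (0 : ℝ), ∃ C > (0 : ℝ), ∀ᶠ t : ℕ in atTop, c * t ≤ f t ∧ (f t : ℝ) ≤ C * t ∧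
      c * (t : ℝ) ^ 2 ≤ edgeCount f v₀ e₀ t ∧ (edgeCount f v₀ e₀ t : ℝ) ≤ C * (t : ℝ) ^ 2 := by
  obtain ⟨C, hC, hub⟩ := hf.1.exists_pos
  obtain ⟨D, hD, hlb⟩ := hf.2.exists_pos
  obtain ⟨N, hN⟩ := eventually_atTop.1 ((hub.bound.and hlb.bound).and (eventually_ge_atTop (v₀ + 1)))
  simp only [Real.norm_natCast] at hN
  set c := D⁻¹ with hc
  have hc0 : 0 < c := by positivity
  have hlow : ∀ t, N ≤ t → c * t ≤ f t := fun t ht => by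
    rw [hc, inv_mul_le_iff₀ hD]; exact (hN t ht).1.2
  -- The third comes from (x+1)² - x² = 2x + 1 ≤ 3x for x ≥ 1.
  have hlower : ∀ j, c / 3 * (((N + j : ℕ) : ℝ) ^ 2 - (N : ℝ) ^ 2) ≤
      edgeCount f v₀ e₀ (N + j) := by
    intro j
    induction j with
    | zero => simp
    | succ j ih =>
      have h1 := hlow (N + j) (by omega)
      have h2 := (hN (N + j) (by omega)).2
      have h3 : (1 : ℝ) ≤ (N + j : ℕ) := by exact_mod_cast (by omega : 1 ≤ N + j)
      rw [← add_assoc, edgeCount_succ (by omega), Nat.cast_add (edgeCount _ _ _ _)]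
      rw [Nat.cast_add (N + j) 1, Nat.cast_one]
      nlinarith
  have hupper : ∀ j, (edgeCount f v₀ e₀ (N + j) : ℝ) ≤
      edgeCount f v₀ e₀ N + C * ((N + j : ℕ) : ℝ) ^ 2 := by
    intro j
    induction j with
    | zero => simp only [Nat.add_zero]; nlinarith [mul_nonneg hC.le (sq_nonneg (N : ℝ))]
    | succ j ih =>
      have h1 := (hN (N + j) (by omega)).1.1
      have h2 := (hN (N + j) (by omega)).2
      have h3 : (0 : ℝ) ≤ (N + j : ℕ) := Nat.cast_nonneg _
      rw [← add_assoc, edgeCount_succ (by omega), Nat.cast_add (edgeCount _ _ _ _)]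
      rw [Nat.cast_add (N + j) 1, Nat.cast_one]
      nlinarith
  -- For t > 2N the term N² is at most t²/4, which leaves c/4 ≥ c/6; the edges present at time N are
  -- absorbed using t² ≥ 1.
  refine ⟨c / 6, by positivity, C + edgeCount f v₀ e₀ N, by positivity, ?_⟩
  filter_upwards [eventually_ge_atTop (2 * N + 1)] with t ht
  obtain ⟨j, rfl⟩ := Nat.exists_eq_add_of_le (by omega : N ≤ t)
  have h1 := hlow (N + j) (by omega)
  have h2 := (hN (N + j) (by omega)).1.1
  have h3 := hlower j
  have h4 := hupper j
  have ht2 : 2 * (N : ℝ) + 1 ≤ (N + j : ℕ) := by exact_mod_cast ht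
  set x : ℝ := ((N + j : ℕ) : ℝ)
  have hN0 : (0 : ℝ) ≤ N := Nat.cast_nonneg _
  have he0 : (0 : ℝ) ≤ edgeCount f v₀ e₀ N := Nat.cast_nonneg _
  have hx1 : 1 ≤ x := by linarith
  refine ⟨?_, ?_, ?_, ?_⟩
  · nlinarith
  · nlinarith
  · have : 4 * (N : ℝ) ^ 2 ≤ x ^ 2 := by nlinarith
    nlinarith
  · have : 1 ≤ x ^ 2 := by nlinarith
    nlinarith

section Growth

variable {f : ℕ → ℕ} {v₀ e₀ : ℕ}

/-- The product e·η² equals f²/(4e), of order t²/t². This is the balance that keeps the number of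
edges to a fixed node of constant order. -/
theorem exists_growthRate_bounds (he : 1 ≤ e₀)
    (hf : (fun t => (f t : ℝ)) =Θ[atTop] (fun t : ℕ => (t : ℝ))) :
    ∃ c > (0 : ℝ), ∃ C > (0 : ℝ), ∀ᶠ t : ℕ in atTop, c * (1 / (t : ℝ)) ≤ growthRate f v₀ e₀ t ∧
      growthRate f v₀ e₀ t ≤ C * (1 / (t : ℝ)) ∧
      c ≤ edgeCount f v₀ e₀ t * growthRate f v₀ e₀ t ^ 2 ∧
      edgeCount f v₀ e₀ t * growthRate f v₀ e₀ t ^ 2 ≤ C := by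
  obtain ⟨c, hc, C, hC, h⟩ := exists_edgeCount_bounds v₀ e₀ hf
  refine ⟨min (c / (2 * C)) (c ^ 2 / (4 * C)), by positivity,
    max (C / (2 * c)) (C ^ 2 / (4 * c)), by positivity, ?_⟩
  filter_upwards [h, eventually_ge_atTop 1] with t ⟨h1, h2, h3, h4⟩ ht
  have ht' : (0 : ℝ) < t := by exact_mod_cast ht
  have hepos : (0 : ℝ) < edgeCount f v₀ e₀ t := by exact_mod_cast edgeCount_pos he
  have hsq : edgeCount f v₀ e₀ t * growthRate f v₀ e₀ t ^ 2 =
      (f t : ℝ) ^ 2 / (4 * edgeCount f v₀ e₀ t) := by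
    unfold growthRate; field_simp; norm_num
  have hlow2 : (c * t) ^ 2 ≤ (f t : ℝ) ^ 2 := by gcongr
  have hup2 : (f t : ℝ) ^ 2 ≤ (C * t) ^ 2 := by gcongr
  refine ⟨(mul_le_mul_of_nonneg_right (min_le_left _ _) (by positivity)).trans ?_,
    le_trans ?_ (mul_le_mul_of_nonneg_right (le_max_left _ _) (by positivity)),
    (min_le_right _ _).trans ?_, le_trans ?_ (le_max_right _ _)⟩
  · calc c / (2 * C) * (1 / t) = c * t / (2 * (C * t ^ 2)) := by field_simp
      _ ≤ _ := by unfold growthRate; gcongr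
  · calc growthRate f v₀ e₀ t ≤ C * t / (2 * (c * t ^ 2)) := by unfold growthRate; gcongr
      _ = _ := by field_simp
  · rw [hsq]
    calc c ^ 2 / (4 * C) = (c * t) ^ 2 / (4 * (C * t ^ 2)) := by field_simp
      _ ≤ _ := by gcongr
  · rw [hsq]
    calc (f t : ℝ) ^ 2 / (4 * edgeCount f v₀ e₀ t) ≤ (C * t) ^ 2 / (4 * (c * t ^ 2)) := by gcongr
      _ = _ := by field_simp

theorem tendsto_sum_growthRate (he : 1 ≤ e₀)
    (hf : (fun t => (f t : ℝ)) =Θ[atTop] (fun t : ℕ => (t : ℝ))) (s : ℕ) :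
    Tendsto (fun l => ∑ i ∈ Finset.range l, growthRate f v₀ e₀ (s + i)) atTop atTop := by
  rw [← not_summable_iff_tendsto_nat_atTop_of_nonneg fun _ => growthRate_nonneg]
  intro hs
  have h1 : Summable fun t => growthRate f v₀ e₀ t :=
    (summable_nat_add_iff s).1 (by simpa [add_comm] using hs)
  obtain ⟨c, hc, C, -, h⟩ := exists_growthRate_bounds (v₀ := v₀) he hf
  have h2 : Summable fun t : ℕ => c * (1 / (t : ℝ)) := by
    refine Summable.of_norm_bounded_eventually_nat h1 ?_
    filter_upwards [h] with t ht
    rw [Real.norm_of_nonneg (by positivity)]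
    exact ht.1
  exact Real.not_summable_one_div_natCast ((summable_mul_left_iff hc.ne').1 h2)

theorem eventually_growthRate_le_one (he : 1 ≤ e₀)
    (hf : (fun t => (f t : ℝ)) =Θ[atTop] (fun t : ℕ => (t : ℝ))) :
    ∀ᶠ t in atTop, growthRate f v₀ e₀ t ≤ 1 := by
  obtain ⟨c, hc, C, hC, h⟩ := exists_growthRate_bounds (v₀ := v₀) he hf
  filter_upwards [h, eventually_ge_atTop (⌈C⌉₊ + 1)] with t ht hCt
  refine ht.2.1.trans ?_
  have h1 : C ≤ t := (Nat.le_ceil C).trans (by exact_mod_cast (by omega : ⌈C⌉₊ ≤ t))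
  rw [mul_one_div, div_le_one (by linarith)]
  exact h1

theorem summable_growthRate_sq (he : 1 ≤ e₀)
    (hf : (fun t => (f t : ℝ)) =Θ[atTop] (fun t : ℕ => (t : ℝ))) :
    Summable fun t => growthRate f v₀ e₀ t ^ 2 := by
  obtain ⟨c, hc, C, hC, h⟩ := exists_growthRate_bounds (v₀ := v₀) he hf
  have h1 : Summable fun t : ℕ => C ^ 2 * (1 / (t : ℝ) ^ 2) :=
    (Real.summable_one_div_nat_pow.2 one_lt_two).mul_left _
  refine Summable.of_norm_bounded_eventually_nat h1 ?_
  filter_upwards [h] with t ht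
  rw [Real.norm_of_nonneg (by positivity)]
  calc growthRate f v₀ e₀ t ^ 2 ≤ (C * (1 / (t : ℝ))) ^ 2 := by
        gcongr
        · exact growthRate_nonneg
        · exact ht.2.1
    _ = _ := by ring

theorem edgeCount_succ_eq_mul (he : 1 ≤ e₀) {t : ℕ} (ht : v₀ ≤ t) :
    (edgeCount f v₀ e₀ (t + 1) : ℝ) = edgeCount f v₀ e₀ t * (1 + 2 * growthRate f v₀ e₀ t) := by
  have hepos : (0 : ℝ) < edgeCount f v₀ e₀ t := by exact_mod_cast edgeCount_pos he
  rw [edgeCount_succ ht, growthRate]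
  push_cast
  field_simp

/-- Stepwise 1 + 2η ≤ (1+η)². The converse bound below loses only a factor exp(η²) per step, and ∑η²
converges. -/
theorem edgeCount_le_mul_growthFactor_sq (he : 1 ≤ e₀) {s : ℕ} (hs : v₀ ≤ s) (l : ℕ) :
    (edgeCount f v₀ e₀ (s + l) : ℝ) ≤ edgeCount f v₀ e₀ s * growthFactor f v₀ e₀ s l ^ 2 := by
  induction l with
  | zero => simp [growthFactor_zero]
  | succ l ih =>
    rw [← add_assoc, edgeCount_succ_eq_mul he (by omega), growthFactor_succ]
    have hη := growthRate_nonneg (f := f) (v₀ := v₀) (e₀ := e₀) (t := s + l)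
    set η := growthRate f v₀ e₀ (s + l)
    have h1 := mul_le_mul_of_nonneg_right ih (by positivity : 0 ≤ 1 + 2 * η)
    have h2 : 0 ≤ edgeCount f v₀ e₀ s * growthFactor f v₀ e₀ s l ^ 2 * η ^ 2 := by positivity
    nlinarith

theorem mul_growthFactor_sq_le (he : 1 ≤ e₀) {s : ℕ} (hs : v₀ ≤ s) (l : ℕ) :
    edgeCount f v₀ e₀ s * growthFactor f v₀ e₀ s l ^ 2 ≤ edgeCount f v₀ e₀ (s + l) *
      Real.exp (∑ i ∈ Finset.range l, growthRate f v₀ e₀ (s + i) ^ 2) := by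
  induction l with
  | zero => simp [growthFactor_zero]
  | succ l ih =>
    rw [← add_assoc, edgeCount_succ_eq_mul he (by omega), growthFactor_succ,
      Finset.sum_range_succ, Real.exp_add]
    have hη := growthRate_nonneg (f := f) (v₀ := v₀) (e₀ := e₀) (t := s + l)
    set η := growthRate f v₀ e₀ (s + l)
    have h1 : (1 + η) ^ 2 ≤ (1 + 2 * η) * Real.exp (η ^ 2) := by
      have := Real.add_one_le_exp (η ^ 2)
      nlinarith [mul_le_mul_of_nonneg_left this (by positivity : 0 ≤ 1 + 2 * η),
        mul_nonneg hη (sq_nonneg η)]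
    calc _ = edgeCount f v₀ e₀ s * growthFactor f v₀ e₀ s l ^ 2 * (1 + η) ^ 2 := by ring
      _ ≤ _ := mul_le_mul ih h1 (by positivity) (by positivity)
      _ = _ := by ring

/-- The square of the product is eη²/e(s) up to a bounded factor, where e is taken at time s + l,
because e(s)·P² is comparable with e. -/
theorem eventually_exists_growthFactor_mul_growthRate_bounds (he : 1 ≤ e₀)
    (hf : (fun t => (f t : ℝ)) =Θ[atTop] (fun t : ℕ => (t : ℝ))) :
    ∀ᶠ s in atTop, ∃ a > 0, ∃ b > 0, ∀ l,
      a ≤ growthFactor f v₀ e₀ s l * growthRate f v₀ e₀ (s + l) ∧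
      growthFactor f v₀ e₀ s l * growthRate f v₀ e₀ (s + l) ≤ b := by
  obtain ⟨c, hc, C, hC, h⟩ := exists_growthRate_bounds (v₀ := v₀) he hf
  obtain ⟨N, hN⟩ := eventually_atTop.1 h
  filter_upwards [eventually_ge_atTop (max N v₀)] with s hs
  have hepos : (0 : ℝ) < edgeCount f v₀ e₀ s := by exact_mod_cast edgeCount_pos he
  have hsum : Summable fun i => growthRate f v₀ e₀ (s + i) ^ 2 := by
    have := (summable_nat_add_iff s).2 (summable_growthRate_sq (v₀ := v₀) he hf)
    simpa [add_comm] using this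
  set K := Real.exp (∑' i, growthRate f v₀ e₀ (s + i) ^ 2) with hK
  refine ⟨√(c / edgeCount f v₀ e₀ s), by positivity, √(C * K / edgeCount f v₀ e₀ s),
    by positivity, fun l => ?_⟩
  obtain ⟨-, -, h3, h4⟩ := hN (s + l) (by omega)
  have h5 := edgeCount_le_mul_growthFactor_sq (f := f) he (by omega : v₀ ≤ s) l
  have h6 := mul_growthFactor_sq_le (f := f) he (by omega : v₀ ≤ s) l
  have h7 : Real.exp (∑ i ∈ Finset.range l, growthRate f v₀ e₀ (s + i) ^ 2) ≤ K :=
    Real.exp_le_exp.2 (hsum.sum_le_tsum _ fun _ _ => sq_nonneg _)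
  have hη := growthRate_nonneg (f := f) (v₀ := v₀) (e₀ := e₀) (t := s + l)
  have hP := growthFactor_pos (f := f) (v₀ := v₀) (e₀ := e₀) (s := s) (l := l)
  constructor
  · apply Real.sqrt_le_iff.2 ⟨by positivity, _⟩
    rw [div_le_iff₀ hepos]
    calc c ≤ _ := h3
      _ ≤ (edgeCount f v₀ e₀ s * growthFactor f v₀ e₀ s l ^ 2) * growthRate f v₀ e₀ (s + l) ^ 2 := by
        gcongr
      _ = _ := by ring
  · apply Real.le_sqrt_of_sq_le
    rw [le_div_iff₀ hepos]
    calc _ = (edgeCount f v₀ e₀ s * growthFactor f v₀ e₀ s l ^ 2) *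
          growthRate f v₀ e₀ (s + l) ^ 2 := by ring
      _ ≤ (edgeCount f v₀ e₀ (s + l) * K) * growthRate f v₀ e₀ (s + l) ^ 2 := by
        have := h6.trans (mul_le_mul_of_nonneg_left h7 (Nat.cast_nonneg _))
        gcongr
      _ = (edgeCount f v₀ e₀ (s + l) * growthRate f v₀ e₀ (s + l) ^ 2) * K := by ring
      _ ≤ C * K := by gcongr

theorem tendsto_natCast_of_isTheta (hf : (fun t => (f t : ℝ)) =Θ[atTop] (fun t : ℕ => (t : ℝ))) :
    Tendsto (fun t => (f t : ℝ)) atTop atTop := by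
  have h0 : Tendsto (fun t : ℕ => (t : ℝ)) atTop atTop := tendsto_natCast_atTop_atTop
  have h := hf.tendsto_norm_atTop_iff.2 (tendsto_norm_atTop_atTop.comp h0)
  refine h.congr fun t => ?_
  simp

end Growth

/-! ### The chance of creating a witness -/

theorem exp_neg_two_mul_le_one_sub {x : ℝ} (h0 : 0 ≤ x) (h : x ≤ 1 / 2) :
    Real.exp (-(2 * x)) ≤ 1 - x := by
  rw [Real.exp_neg, inv_le_iff_one_le_mul₀ (Real.exp_pos _)]
  nlinarith [Real.add_one_le_exp (2 * x)]

/-- The probability that `k` samples hit each `u i` exactly `m i` times is bounded from below when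
the expected numbers of hits lie in `[A, B]` and `k` is large. -/
theorem le_iidExp_hitCount_eq_of_bounds {V : Type*} [Fintype V] [DecidableEq V] {p : V → ℝ} {k : ℕ}
    (hp0 : ∀ a, 0 ≤ p a) (hp : ∑ a, p a = 1) {n : ℕ} {u : Fin n → V}
    (hu : Function.Injective u) (m : Fin n → ℕ) {A B : ℝ} (hA : 0 < A)
    (hk0 : 0 < k) (hk1 : 2 * ∑ i, m i ≤ k) (hk2 : 2 * (n * B) ≤ k)
    (hlow : ∀ i, A ≤ k * p (u i)) (hup : ∀ i, k * p (u i) ≤ B) :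
    (A / 2) ^ (∑ i, m i) / (∑ i, m i).factorial * Real.exp (-(2 * (n * B))) ≤
      iidExp p k (fun c => if ∀ i, hitCount c (u i) = m i then 1 else 0) := by
  refine le_trans ?_ (le_iidExp_hitCount_eq hp0 hp hu m)
  set M := ∑ i, m i with hM
  have hk : (0 : ℝ) < k := by exact_mod_cast hk0
  have h1 : ((k : ℝ) / 2) ^ M / M.factorial ≤ k.choose M := by
    refine le_trans ?_ (Nat.pow_le_choose (α := ℝ) M k)
    gcongr
    have : (k : ℝ) / 2 = ((k : ℝ) + 1) - (k / 2 + 1) := by ring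
    rw [Nat.cast_sub (by omega), Nat.cast_add, Nat.cast_one]
    have : (2 : ℝ) * M ≤ k := by exact_mod_cast hk1
    linarith
  have h2 : (A / k) ^ M ≤ ∏ i, p (u i) ^ m i := by
    rw [hM, ← Finset.prod_pow_eq_pow_sum]
    refine Finset.prod_le_prod (fun _ _ => by positivity) fun i _ => ?_
    have : A / k ≤ p (u i) := by rw [div_le_iff₀ hk, mul_comm]; exact hlow i
    gcongr
  have h3 : ∑ i, p (u i) ≤ n * B / k := by
    calc ∑ i, p (u i) ≤ ∑ _i : Fin n, B / k :=
          Finset.sum_le_sum fun i _ => by rw [le_div_iff₀ hk, mul_comm]; exact hup i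
      _ = n * B / k := by simp [mul_div_assoc]
  have h3' : 0 ≤ ∑ i, p (u i) := Finset.sum_nonneg fun i _ => hp0 _
  have h4 : n * B / k ≤ 1 / 2 := by rw [div_le_iff₀ hk]; linarith
  -- Apply exp(-2x) ≤ 1 - x with x = nB/k ≤ 1/2, to the power k.
  have h5 : Real.exp (-(2 * (n * B))) ≤ (1 - ∑ i, p (u i)) ^ k := by
    calc Real.exp (-(2 * (n * B))) = Real.exp (-(2 * (n * B / k))) ^ k := by
          rw [← Real.exp_nat_mul]; congr 1; field_simp
      _ ≤ (1 - n * B / k) ^ k := by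
          gcongr
          exact exp_neg_two_mul_le_one_sub (h3'.trans h3) h4
      _ ≤ _ := pow_le_pow_left₀ (by linarith) (by linarith) _
  calc _ = ((k : ℝ) / 2) ^ M / M.factorial * (A / k) ^ M * Real.exp (-(2 * (n * B))) := by
        have : A / 2 = k / 2 * (A / k) := by field_simp
        rw [this, mul_pow]
        ring
    _ ≤ _ := by
        have : 0 ≤ ∏ i, p (u i) ^ m i := le_trans (by positivity) h2
        gcongr

open Classical in
/-- The indicator function of the absence of a witness. -/
noncomputable def noWitness {n : ℕ} (u m : Fin n → ℕ) (G : DirMultigraph) : ℝ :=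
  if G.HasWitness u m then 0 else 1

section Witness

variable {f : ℕ → ℕ} {v₀ e₀ t : ℕ} {G : DirMultigraph} {n : ℕ} {u m : Fin n → ℕ}

theorem noWitness_nonneg : 0 ≤ noWitness u m G := by
  unfold noWitness; split_ifs <;> norm_num

theorem noWitness_le_one : noWitness u m G ≤ 1 := by
  unfold noWitness; split_ifs <;> norm_num

theorem stepExp_noWitness_le (hG : IsState f v₀ e₀ t G) (he : 1 ≤ e₀) (ht : v₀ ≤ t) :
    stepExp f v₀ t (noWitness u m) G ≤ noWitness u m G := by
  rw [stepExp_eq hG he ht]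
  refine (iidExp_mono (F' := fun _ => noWitness u m G) G.weight_nonneg fun c => ?_).trans
    (iidExp_const (DirMultigraph.sum_weight (hG.edges_ne_zero he)) _).le
  by_cases h : G.HasWitness u m
  · simp [noWitness, h, h.attach (hG.succ_notMem ht) c]
  · simpa [noWitness, h] using noWitness_le_one

/-- If there is no witness yet, the new node itself becomes one with the probability bounded in
`le_iidExp_hitCount_eq_of_bounds`. -/
theorem stepExp_noWitness_le_one_sub_mul (hG : IsState f v₀ e₀ t G) (he : 1 ≤ e₀) (ht : v₀ ≤ t)
    (hu : Function.Injective u) (hu1 : ∀ i, 1 ≤ u i) (hut : ∀ i, u i ≤ t) {A B : ℝ} (hA : 0 < A)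
    (hk0 : 0 < f t) (hk1 : 2 * ∑ i, m i ≤ f t) (hk2 : 2 * (n * B) ≤ f t)
    (hlow : ∀ i, A ≤ G.degree (u i) * growthRate f v₀ e₀ t)
    (hup : ∀ i, G.degree (u i) * growthRate f v₀ e₀ t ≤ B) :
    stepExp f v₀ t (noWitness u m) G ≤ (1 - (A / 2) ^ (∑ i, m i) / (∑ i, m i).factorial *
      Real.exp (-(2 * (n * B)))) * noWitness u m G := by
  by_cases h : G.HasWitness u m
  · have := stepExp_noWitness_le (u := u) (m := m) hG he ht
    simpa [noWitness, h] using this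
  have hv := hG.succ_notMem ht
  set w : Fin n → G.verts := fun i => ⟨u i, (hG.mem_verts ht).2 ⟨hu1 i, hut i⟩⟩ with hw
  have hwinj : Function.Injective w := fun i j hij => hu (congrArg Subtype.val hij)
  have hsum := DirMultigraph.sum_weight (hG.edges_ne_zero he)
  have h1 := le_iidExp_hitCount_eq_of_bounds G.weight_nonneg hsum hwinj m (B := B) hA hk0 hk1 hk2
    (fun i => by rw [hG.mul_weight]; exact hlow i) (fun i => by rw [hG.mul_weight]; exact hup i)
  have h2 : noWitness u m G = 1 := by simp [noWitness, h]
  rw [h2, mul_one, stepExp_eq hG he ht]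
  have h3 : iidExp G.weight (f t) (fun c => noWitness u m (G.attach (t + 1) c)) ≤
      iidExp G.weight (f t)
        (fun c => 1 + -1 * if ∀ i, hitCount c (w i) = m i then 1 else 0) := by
    refine iidExp_mono G.weight_nonneg fun c => ?_
    split_ifs with hc
    · have := DirMultigraph.hasWitness_attach hv c hc
      simp only [hw] at this
      simp [noWitness, this]
    · simpa using noWitness_le_one
  rw [iidExp_add, iidExp_const hsum, iidExp_const_mul] at h3
  linarith

open Classical in
theorem eventually_chainExp_noWitness_lt {t₀ : ℕ} (hG : IsState f v₀ e₀ t₀ G) (he : 1 ≤ e₀)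
    (hfpos : ∀ t, v₀ ≤ t → 1 ≤ f t)
    (hf : (fun t => (f t : ℝ)) =Θ[atTop] (fun t : ℕ => (t : ℝ)))
    (hu : Function.Injective u) (hu1 : ∀ i, 1 ≤ u i) {ε : ℝ} (hε : 0 < ε) :
    ∀ᶠ l in atTop, chainExp f v₀ t₀ l (noWitness u m) G < ε := by
  have hshift : Tendsto (fun l => t₀ + l) atTop atTop := tendsto_add_atTop_iff_nat t₀ |>.2
    tendsto_id |>.congr fun l => add_comm _ _
  have hnodes : ∀ᶠ l in atTop, v₀ ≤ t₀ + l ∧ ∀ i, u i ≤ t₀ + l :=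
    hshift.eventually ((eventually_ge_atTop v₀).and
      (eventually_all.2 fun i => eventually_ge_atTop (u i)))
  -- The 8(n+1) leaves ε/(2(n+1)) per node after Chebyshev's factor 4, hence at most ε/2 for all n
  -- nodes.
  have hinv : ∀ i, ∀ᶠ l in atTop,
      chainExp f v₀ t₀ l (fun G => (G.degree (u i) : ℝ)⁻¹) G < ε / (8 * (n + 1)) := by
    intro i
    obtain ⟨N, hN⟩ := eventually_atTop.1
      (hnodes.and (hshift.eventually (eventually_growthRate_le_one (v₀ := v₀) he hf)))
    have hnn : ∀ l, 0 ≤ chainExp f v₀ t₀ l (fun G => (G.degree (u i) : ℝ)⁻¹) G := fun l => by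
      have := chainExp_mono (l := l) (F := fun _ => 0) (F' := fun G => (G.degree (u i) : ℝ)⁻¹)
        he hfpos hG fun _ _ => by positivity
      rwa [chainExp_const] at this
    refine eventually_lt_of_le_sub_mul_sq (N := N) (fun l _ => hnn l) (fun l => growthRate_nonneg)
      (fun l hl => ?_) (tendsto_sum_growthRate (v₀ := v₀) he hf t₀) (by positivity)
    obtain ⟨⟨h1, h2⟩, h3⟩ := hN l hl
    set y := chainExp f v₀ t₀ l (fun G => (G.degree (u i) : ℝ)⁻¹) G with hy
    set η := growthRate f v₀ e₀ (t₀ + l) with hη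
    have hη0 : 0 ≤ η := growthRate_nonneg
    -- Jensen's inequality in tangent form: x² ≥ 2xy - y², where x is the inverse degree and y its
    -- mean. The right side is affine in x, so it passes through `chainExp`.
    have key : ∀ G', IsState f v₀ e₀ (t₀ + l) G' →
        stepExp f v₀ (t₀ + l) (fun G => (G.degree (u i) : ℝ)⁻¹) G' ≤
          (1 - η / 2 * y) * (G'.degree (u i) : ℝ)⁻¹ + η / 4 * y ^ 2 := by
      intro G' hG'
      refine (stepExp_inv_degree_le hG' he h1 (hu1 i) (h2 i) h3).trans ?_
      nlinarith [mul_nonneg hη0 (sq_nonneg ((G'.degree (u i) : ℝ)⁻¹ - y))]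
    refine (chainExp_mono he hfpos hG key).trans ?_
    simp only [chainExp_add, chainExp_const_mul, chainExp_const]
    rw [← hy]
    nlinarith
  have hgrow := eventually_exists_growthFactor_mul_growthRate_bounds (v₀ := v₀) he hf
  -- Fixes the time T at which the degree estimates are restarted.
  obtain ⟨l₁, ⟨hv₁, hu₁⟩, hl₁, a, ha, b, hb, hab⟩ :=
    (hnodes.and ((eventually_all.2 hinv).and (hshift.eventually hgrow))).exists
  set T := t₀ + l₁ with hT
  set E : ℝ := (edgeCount f v₀ e₀ T : ℝ) with hE
  have hE1 : 1 ≤ E := by rw [hE]; exact_mod_cast edgeCount_pos he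
  set M := ∑ i, m i with hM
  -- In the window [P/2, 3EP] and with a ≤ Pη ≤ b, the mean numbers of hits lie in [a/2, B].
  set B := 3 * E * b with hB
  set δ := min 1 ((a / 2 / 2) ^ M / M.factorial * Real.exp (-(2 * (n * B)))) with hδ
  have hδ0 : 0 < δ := by positivity
  obtain ⟨N, hN⟩ := eventually_atTop.1 ((tendsto_natCast_of_isTheta hf).eventually
    (eventually_ge_atTop (max (max 1 (2 * (M : ℝ))) (2 * (n * B)))))
  have hmain : ∀ᶠ l in atTop, chainExp f v₀ t₀ l (noWitness u m) G < ε / 2 + ε / 2 := by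
    refine eventually_lt_of_le_contraction (N := max N l₁) hδ0 (min_le_left _ _) ?_
      (by positivity) (fun l hl => ?_) (by positivity)
    · have := chainExp_mono (l := max N l₁) (F' := fun _ => 1) he hfpos hG
        fun G' _ => noWitness_le_one (u := u) (m := m) (G := G')
      rwa [chainExp_const] at this
    obtain ⟨j, rfl⟩ := Nat.exists_eq_add_of_le (by omega : l₁ ≤ l)
    have hTj : t₀ + (l₁ + j) = T + j := by omega
    set P := growthFactor f v₀ e₀ T j with hP
    set η := growthRate f v₀ e₀ (T + j) with hη
    have hη0 : 0 ≤ η := growthRate_nonneg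
    obtain ⟨hab1, hab2⟩ := hab j
    have hfk := hN (T + j) (by omega)
    have hk0 : (1 : ℝ) ≤ f (T + j) := ((le_max_left _ _).trans (le_max_left _ _)).trans hfk
    have hk1 : 2 * (M : ℝ) ≤ f (T + j) := ((le_max_right _ _).trans (le_max_left _ _)).trans hfk
    have hk2 : 2 * (n * B) ≤ f (T + j) := (le_max_right _ _).trans hfk
    set bad : Fin n → DirMultigraph → ℝ := fun i G' =>
      if P / 2 ≤ G'.degree (u i) ∧ (G'.degree (u i) : ℝ) ≤ 3 * E * P then 0 else 1 with hbad
    -- If all degrees lie in the window, the absence of a witness contracts by 1 - δ. Otherwise ∑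
    -- bad ≥ 1, and the term δ·∑ bad makes up for the missing contraction because the indicator is
    -- at most 1.
    have key : ∀ G', IsState f v₀ e₀ (t₀ + (l₁ + j)) G' →
        stepExp f v₀ (t₀ + (l₁ + j)) (noWitness u m) G' ≤
          (1 - δ) * noWitness u m G' + δ * ∑ i, bad i G' := by
      rw [hTj]
      intro G' hG'
      have hbad0 : ∀ i, 0 ≤ bad i G' := fun i => by simp only [hbad]; split_ifs <;> norm_num
      by_cases h : ∀ i, P / 2 ≤ G'.degree (u i) ∧ (G'.degree (u i) : ℝ) ≤ 3 * E * P
      · have h1 := stepExp_noWitness_le_one_sub_mul (m := m) (A := a / 2) (B := B) hG' he (by omega)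
          hu hu1 (fun i => (hu₁ i).trans (by omega)) (by positivity) (by exact_mod_cast hk0)
          (by exact_mod_cast hk1) hk2
          (fun i => by
            have := mul_le_mul_of_nonneg_right (h i).1 hη0
            linarith)
          (fun i => by
            have := mul_le_mul_of_nonneg_right (h i).2 hη0
            have := mul_le_mul_of_nonneg_left hab2 (by linarith : 0 ≤ 3 * E)
            linarith)
        have h2 : δ ≤ (a / 2 / 2) ^ M / M.factorial * Real.exp (-(2 * (n * B))) := min_le_right _ _
        have h3 := mul_le_mul_of_nonneg_right h2 (noWitness_nonneg (u := u) (m := m) (G := G'))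
        have h4 : 0 ≤ δ * ∑ i, bad i G' :=
          mul_nonneg hδ0.le (Finset.sum_nonneg fun i _ => hbad0 i)
        linarith
      · push Not at h
        obtain ⟨i, hi⟩ := h
        have h1 : (1 : ℝ) ≤ ∑ i, bad i G' := by
          refine le_trans (le_of_eq ?_)
            (Finset.single_le_sum (fun i _ => hbad0 i) (Finset.mem_univ i))
          simp only [hbad]
          rw [if_neg]
          rintro ⟨h5, h6⟩
          exact absurd h6 (not_le.2 (hi h5))
        have h2 := stepExp_noWitness_le (u := u) (m := m) hG' he (by omega)
        have h3 := noWitness_le_one (u := u) (m := m) (G := G')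
        nlinarith
    refine (chainExp_mono he hfpos hG key).trans ?_
    simp only [chainExp_add, chainExp_const_mul, chainExp_sum]
    have hsum : ∑ i, chainExp f v₀ t₀ (l₁ + j) (bad i) G ≤ ε / 2 := by
      have h1 : ∀ i, chainExp f v₀ t₀ (l₁ + j) (bad i) G ≤ ε / (2 * (n + 1)) := by
        intro i
        -- Chebyshev from time T, then the average of 4/deg over the states at time T.
        rw [chainExp_chainExp]
        refine (chainExp_mono he hfpos hG fun G' hG' =>
          chainExp_degree_deviation_le hG' he hfpos hv₁ (hu1 i) (hu₁ i)).trans ?_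
        rw [chainExp_const_mul]
        have := hl₁ i
        calc _ ≤ 4 * (ε / (8 * (n + 1))) := by linarith
          _ = _ := by field_simp; norm_num
      calc _ ≤ ∑ _i : Fin n, ε / (2 * (n + 1)) := Finset.sum_le_sum fun i _ => h1 i
        _ = ε / 2 * (n / (n + 1)) := by simp; field_simp
        _ ≤ ε / 2 * 1 := by
          gcongr
          rw [div_le_one (by positivity)]
          linarith
        _ = _ := mul_one _
    have := mul_le_mul_of_nonneg_left hsum hδ0.le
    linarith
  simpa using hmain

end Witness

/-! ### From finite sums to the law of the process -/

theorem PMF.lintegral_toMeasure {α : Type*} [MeasurableSpace α] (p : PMF α) {F : α → ℝ≥0∞}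
    (hF : Measurable F) : ∫⁻ a, F a ∂p.toMeasure = ∑' a, p a * F a := by
  have h : p.toMeasure = Measure.sum fun a => p a • Measure.dirac a := by
    ext s hs
    rw [PMF.toMeasure_apply _ hs, Measure.sum_apply _ hs]
    refine tsum_congr fun a => ?_
    by_cases ha : a ∈ s <;> simp [Measure.dirac_apply' _ hs, ha]
  rw [h, lintegral_sum_measure]
  simp [lintegral_dirac' _ hF]

theorem PMF.tsum_map_mul {α β : Type*} (p : PMF α) (φ : α → β) (F : β → ℝ≥0∞) :
    ∑' b, p.map φ b * F b = ∑' a, p a * F (φ a) := by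
  classical
  simp only [PMF.map_apply, ← ENNReal.tsum_mul_right]
  rw [ENNReal.tsum_comm]
  refine tsum_congr fun a => ?_
  rw [tsum_eq_single (φ a) fun b hb => by simp [hb]]
  simp

namespace DirMultigraph

theorem measurable_eval {ι β : Type*} [MeasurableSpace β] (φ : DirMultigraph → β) (i : ι) :
    Measurable fun h : ι → DirMultigraph => φ (h i) :=
  (measurable_from_top (f := φ)).comp (measurable_pi_apply i)

theorem measurableSet_eval {ι : Type*} (P : DirMultigraph → Prop) (i : ι) :
    MeasurableSet {h : ι → DirMultigraph | P (h i)} :=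
  measurableSet_setOfPred.2 (measurable_eval P i)

theorem endpointPMF_apply {G : DirMultigraph} (h : G.edges ≠ 0) (u : G.verts) :
    G.endpointPMF h u = ENNReal.ofReal (G.weight u) := by
  have h1 : ∑' w : G.verts, (G.degree w : ℝ≥0∞) = ((2 * Multiset.card G.edges : ℕ) : ℝ≥0∞) := by
    rw [tsum_fintype, Finset.sum_coe_sort G.verts fun w => (G.degree w : ℝ≥0∞),
      ← Nat.cast_sum, G.sum_degree]
  have h2 : 0 < Multiset.card G.edges := Multiset.card_pos.2 h
  rw [endpointPMF, PMF.normalize_apply, h1, weight, ENNReal.ofReal_div_of_pos (by positivity),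
    ENNReal.ofReal_natCast, div_eq_mul_inv]
  congr 2
  rw [← ENNReal.ofReal_natCast]
  push_cast
  rfl

end DirMultigraph

section Law

variable {f : ℕ → ℕ} {v₀ e₀ s t l : ℕ} {G : DirMultigraph} {F : DirMultigraph → ℝ}

theorem stepExp_nonneg (hF : ∀ G, 0 ≤ F G) (G : DirMultigraph) : 0 ≤ stepExp f v₀ t F G := by
  unfold stepExp
  split_ifs
  · exact hF G
  · exact iidExp_nonneg G.weight_nonneg fun c => hF _

theorem lintegral_mpaStep (hF : ∀ G, 0 ≤ F G) (G : DirMultigraph) :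
    ∫⁻ G', ENNReal.ofReal (F G') ∂(mpaStep f v₀ t G).toMeasure =
      ENNReal.ofReal (stepExp f v₀ t F G) := by
  have hpure : ∫⁻ G', ENNReal.ofReal (F G') ∂(PMF.pure G).toMeasure = ENNReal.ofReal (F G) := by
    rw [PMF.toMeasure_pure, lintegral_dirac' _ measurable_from_top]
  unfold mpaStep stepExp
  by_cases ht : t < v₀
  · rw [if_pos ht, if_pos (Or.inl ht), hpure]
  by_cases he : G.edges = 0
  · rw [if_neg ht, if_pos (Or.inr he), attachPMF, dif_neg (by simpa using he), hpure]
  rw [if_neg ht, if_neg (by tauto), attachPMF, dif_pos he,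
    PMF.lintegral_toMeasure _ measurable_from_top, PMF.tsum_map_mul, tsum_fintype, iidExp,
    ENNReal.ofReal_sum_of_nonneg fun c _ => mul_nonneg
      (Finset.prod_nonneg fun _ _ => G.weight_nonneg _) (hF _)]
  refine Finset.sum_congr rfl fun c _ => ?_
  rw [ENNReal.ofReal_mul (Finset.prod_nonneg fun _ _ => G.weight_nonneg _),
    ENNReal.ofReal_prod_of_nonneg fun _ _ => G.weight_nonneg _]
  simp [iidPMF, DirMultigraph.endpointPMF_apply he]

/-- History and next state are jointly distributed as a composition product with the kernel.
Allowing any event `A` of the history keeps a condition on an earlier state available at later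
steps. -/
theorem setLIntegral_mpaMeasure_succ (f : ℕ → ℕ) (G₀ : DirMultigraph) (t : ℕ)
    {A : Set (∀ _ : Finset.Iic t, DirMultigraph)} (hA : MeasurableSet A)
    (hF : ∀ G, 0 ≤ F G) :
    ∫⁻ ω in Preorder.frestrictLe t ⁻¹' A, ENNReal.ofReal (F (ω (t + 1))) ∂mpaMeasure f G₀ =
      ∫⁻ ω in Preorder.frestrictLe t ⁻¹' A,
        ENNReal.ofReal (stepExp f G₀.verts.card t F (ω t)) ∂mpaMeasure f G₀ := by
  have hlaw := Kernel.map_frestrictLe_trajMeasure_compProd_eq_map_trajMeasure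
    (X := fun _ => DirMultigraph) (μ₀ := Measure.dirac G₀) (κ := mpaKernel f G₀.verts.card) (a := t)
  change (mpaMeasure f G₀).map (Preorder.frestrictLe t) ⊗ₘ _ = (mpaMeasure f G₀).map _ at hlaw
  have hm : Measurable (Preorder.frestrictLe (π := fun _ : ℕ => DirMultigraph) t) := by fun_prop
  have hm' : Measurable fun ω : ℕ → DirMultigraph =>
      (Preorder.frestrictLe (π := fun _ : ℕ => DirMultigraph) t ω, ω (t + 1)) := by
    fun_prop
  have hFm : Measurable fun z : (∀ _ : Finset.Iic t, DirMultigraph) × DirMultigraph =>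
      ENNReal.ofReal (F z.2) :=
    (measurable_from_top (f := fun G => ENNReal.ofReal (F G))).comp measurable_snd
  have h1 := Measure.setLIntegral_compProd (μ := (mpaMeasure f G₀).map (Preorder.frestrictLe t))
    (κ := mpaKernel f G₀.verts.card t) (f := fun z => ENNReal.ofReal (F z.2))
    hFm hA MeasurableSet.univ
  rw [hlaw, setLIntegral_map (hA.prod MeasurableSet.univ) hFm hm'] at h1
  simp only [Measure.restrict_univ] at h1
  have h2 : ∀ h : ∀ _ : Finset.Iic t, DirMultigraph,
      ∫⁻ G, ENNReal.ofReal (F G) ∂(mpaKernel f G₀.verts.card t h) =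
        ENNReal.ofReal (stepExp f G₀.verts.card t F (h ⟨t, Finset.mem_Iic.2 le_rfl⟩)) :=
    fun h => lintegral_mpaStep hF _
  simp only [h2] at h1
  rw [setLIntegral_map hA (DirMultigraph.measurable_eval
    (fun G => ENNReal.ofReal (stepExp f G₀.verts.card t F G)) _) hm] at h1
  have h3 : (fun ω : ℕ → DirMultigraph =>
      (Preorder.frestrictLe (π := fun _ : ℕ => DirMultigraph) t ω, ω (t + 1))) ⁻¹'
      (A ×ˢ Set.univ) = Preorder.frestrictLe t ⁻¹' A := by
    ext ω; simp
  rw [h3] at h1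
  exact h1

/-- Iterates the one-step formula. The product form, instead of a quotient, also covers null states
`g`. -/
theorem setLIntegral_mpaMeasure (f : ℕ → ℕ) (G₀ g : DirMultigraph) (s l : ℕ)
    (hF : ∀ G, 0 ≤ F G) :
    ∫⁻ ω in {ω | ω s = g}, ENNReal.ofReal (F (ω (s + l))) ∂mpaMeasure f G₀ =
      ENNReal.ofReal (chainExp f G₀.verts.card s l F g) * mpaMeasure f G₀ {ω | ω s = g} := by
  induction l generalizing F with
  | zero =>
    rw [← setLIntegral_const]
    refine setLIntegral_congr_fun (DirMultigraph.measurableSet_eval (· = g) s) fun ω hω => ?_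
    have : ω s = g := hω
    simp [chainExp, this]
  | succ l ih =>
    rw [chainExp, ← ih fun G => stepExp_nonneg hF G]
    have hA : MeasurableSet {h : ∀ _ : Finset.Iic (s + l), DirMultigraph |
        h ⟨s, Finset.mem_Iic.2 (by omega)⟩ = g} :=
      DirMultigraph.measurableSet_eval (· = g) _
    exact setLIntegral_mpaMeasure_succ f G₀ (s + l) hA hF

theorem ae_mpaMeasure_zero (f : ℕ → ℕ) (G₀ : DirMultigraph) :
    ∀ᵐ ω ∂mpaMeasure f G₀, ω 0 = G₀ := by
  have hmap : (mpaMeasure f G₀).map (Preorder.frestrictLe 0) =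
      (Measure.dirac G₀).map (MeasurableEquiv.piUnique fun _ : Finset.Iic 0 => DirMultigraph).symm := by
    rw [mpaMeasure, Kernel.trajMeasure, Measure.map_comp _ _ (by fun_prop),
      Kernel.traj_map_frestrictLe, Kernel.partialTraj_self, Measure.id_comp]
  rw [Measure.map_dirac' (by fun_prop)] at hmap
  have hA : MeasurableSet {h : ∀ _ : Finset.Iic 0, DirMultigraph |
      h ⟨0, Finset.mem_Iic.2 le_rfl⟩ = G₀} :=
    DirMultigraph.measurableSet_eval (· = G₀) _
  have h1 : ∀ᵐ h ∂(mpaMeasure f G₀).map (Preorder.frestrictLe 0),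
      h ⟨0, Finset.mem_Iic.2 le_rfl⟩ = G₀ := by
    rw [hmap, ae_dirac_iff hA]
    rfl
  exact ae_of_ae_map (by fun_prop) h1

-- The indicator of failure has one-step expectation 0 from every valid state.
open Classical in
theorem ae_isState {G₀ : DirMultigraph} (he : 1 ≤ e₀)
    (hf : ∀ t, G₀.verts.card ≤ t → 1 ≤ f t) (h₀ : IsState f G₀.verts.card e₀ 0 G₀) (t : ℕ) :
    ∀ᵐ ω ∂mpaMeasure f G₀, IsState f G₀.verts.card e₀ t (ω t) := by
  induction t with
  | zero =>
    filter_upwards [ae_mpaMeasure_zero f G₀] with ω hω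
    rwa [hω]
  | succ t ih =>
    set F : DirMultigraph → ℝ := fun G => if IsState f G₀.verts.card e₀ (t + 1) G then 0 else 1
    have hF : ∀ G, 0 ≤ F G := fun G => by simp only [F]; split_ifs <;> norm_num
    have h1 := setLIntegral_mpaMeasure_succ f G₀ t MeasurableSet.univ hF
    simp only [Set.preimage_univ, Measure.restrict_univ] at h1
    have h2 : ∫⁻ ω, ENNReal.ofReal (stepExp f G₀.verts.card t F (ω t)) ∂mpaMeasure f G₀ = 0 := by
      rw [lintegral_eq_zero_iff (DirMultigraph.measurable_eval
        (fun G => ENNReal.ofReal (stepExp f G₀.verts.card t F G)) _)]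
      filter_upwards [ih] with ω hω
      have h3 := stepExp_mono (F := F) (F' := fun _ => 0) he hf hω fun G' hG' => by simp [F, hG']
      rw [stepExp_const] at h3
      simpa using h3
    rw [h2, lintegral_eq_zero_iff (DirMultigraph.measurable_eval (fun G => ENNReal.ofReal (F G)) _)] at h1
    filter_upwards [h1] with ω hω
    by_contra hc
    simp [F, hc] at hω

end Law

theorem proposition5p2
    (G₀ : DirMultigraph)
    -- the nodes of the initial multigraph are `1, …, v₀`, and none of them is isolated
    (hverts : G₀.verts = Finset.Icc 1 G₀.verts.card)
    (hisol : ∀ u ∈ G₀.verts, G₀.degree u ≠ 0)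
    (f : ℕ → ℕ)
    (hf_init : f 0 = Multiset.card G₀.edges)
    (hf_zero : ∀ t, 1 ≤ t → t < G₀.verts.card → f t = 0)
    (hf_pos : ∀ t, G₀.verts.card ≤ t → 1 ≤ f t)
    (hf : (fun t => (f t : ℝ)) =Θ[atTop] (fun t : ℕ => (t : ℝ)))
    -- a state that the process can have at time `t₀`
    (t₀ : ℕ) (ht₀ : 1 ≤ t₀) (g : DirMultigraph)
    (hg : mpaMeasure f G₀ {ω | ω t₀ = g} ≠ 0)
    -- a witness request
    (n : ℕ) (u m : Fin n → ℕ) (hu : Function.Injective u) (hu_pos : ∀ i, 1 ≤ u i)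
    (ε : ℝ) (hε : 0 < ε) :
    ∃ t₁ > t₀,
      1 - ε < ((mpaMeasure f G₀)[|{ω | ω t₀ = g}]).real {ω | (ω t₁).HasWitness u m} := by
  have he : 1 ≤ Multiset.card G₀.edges := by
    by_contra! h
    have h1 : ∑ w ∈ G₀.verts, G₀.degree w = 0 := by rw [G₀.sum_degree]; omega
    have h2 : G₀.verts = ∅ := Finset.eq_empty_of_forall_notMem fun w hw =>
      hisol w hw (Finset.sum_eq_zero_iff.1 h1 w hw)
    -- Without edges every node would be isolated, so there would be none; then positivity of `f`
    -- already holds at time 0, against f(0) = 0 edges.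
    have h3 := hf_pos 0 (by rw [h2]; rfl)
    omega
  have h₀ : IsState f G₀.verts.card (Multiset.card G₀.edges) 0 G₀ :=
    ⟨by rw [max_eq_right (Nat.zero_le _)]; exact hverts, by simp [edgeCount], hisol⟩
  -- Almost surely the process is in a valid state at time `t₀`, and `g` has positive probability.
  have hgs : IsState f G₀.verts.card (Multiset.card G₀.edges) t₀ g := by
    by_contra hc
    refine hg (measure_mono_null ?_ (ae_isState he hf_pos h₀ t₀))
    rintro ω (hω : ω t₀ = g) h
    exact hc (hω ▸ h)
  obtain ⟨l, hl, hl1⟩ := ((eventually_chainExp_noWitness_lt (m := m) hgs he hf_pos hf hu hu_pos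
    hε).and (eventually_ge_atTop 1)).exists
  refine ⟨t₀ + l, by omega, ?_⟩
  set μ := mpaMeasure f G₀
  set B := {ω : ℕ → DirMultigraph | ω t₀ = g}
  have hB : MeasurableSet B := DirMultigraph.measurableSet_eval (· = g) t₀
  set W := {ω : ℕ → DirMultigraph | (ω (t₀ + l)).HasWitness u m}
  have hW : MeasurableSet W := DirMultigraph.measurableSet_eval (·.HasWitness u m) (t₀ + l)
  have h1 := setLIntegral_mpaMeasure f G₀ g t₀ l fun G => noWitness_nonneg (u := u) (m := m) (G := G)
  have h2 : ∀ ω : ℕ → DirMultigraph,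
      ENNReal.ofReal (noWitness u m (ω (t₀ + l))) = Wᶜ.indicator 1 ω := fun ω => by
    by_cases h : (ω (t₀ + l)).HasWitness u m <;> simp [noWitness, W, h]
  simp only [h2] at h1
  rw [lintegral_indicator_one hW.compl, Measure.restrict_apply hW.compl, Set.inter_comm] at h1
  have : IsProbabilityMeasure μ[|B] := cond_isProbabilityMeasure hg
  have h3 : μ[|B].real Wᶜ = chainExp f G₀.verts.card t₀ l (noWitness u m) g := by
    have h4 : 0 ≤ chainExp f G₀.verts.card t₀ l (noWitness u m) g := by
      have := chainExp_mono (l := l) (F := fun _ => 0) he hf_pos hgs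
        fun G' _ => noWitness_nonneg (u := u) (m := m) (G := G')
      rwa [chainExp_const] at this
    rw [measureReal_def, cond_apply hB, h1, mul_comm, mul_assoc,
      ENNReal.mul_inv_cancel hg (measure_ne_top _ _), mul_one, ENNReal.toReal_ofReal h4]
  have h5 := probReal_add_probReal_compl (μ := μ[|B]) hW
  linarith
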